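/- For $z\in\mathbb{C}\setminus(-\infty,0]$ and $\mu\in\mathbb{C}$ let $z^\mu=e^{\mu\,\mathrm{Log}\,z}$ (principal logarithm), $\sqrt z=z^{1/2}$, and let $$I_\mu(z)=\Big(\frac z2\Big)^{\mu}\sum_{m=0}^\infty\frac{1}{m!\,\Gamma(\mu+m+1)}\Big(\frac z2\Big)^{2m},\qquad K_\mu(z)=\frac{\pi}{2}\,\frac{I_{-\mu}(z)-I_\mu(z)}{\sin(\mu\pi)}\quad(\mu\notin\mathbb{Z})$$ be the modified Bessel functions. For an integer $n$ with $|n|=1$ and $\beta>0$ put $\mu_n=\mu_n(\beta)=(n^2+in\beta)^{1/2}$ with $\mathrm{Re}(\mu_n)>0$, and $$F_n(\sqrt\lambda;\beta)=\int_1^\infty s^{1-|n|}K_{\mu_n}(\sqrt\lambda\,s)\,ds,\qquad \lambda\in\mathbb{C}\setminus(-\infty,0].$$ Let $\Sigma_\phi=\{z\in\mathbb{C}\setminus\{0\}: |\arg z|<\phi\}$ and $\mathcal{B}_\rho(0)=\{z\in\mathbb{C}:|z|<\rho\}$. For every $\epsilon\in(0,\frac\pi2)$ there are positive constants $\beta_0$,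 $c$ and $C$, depending only on $\epsilon$, such that for all $n$ with $|n|=1$ and all $\beta\in(0,\beta_0)$ the following hold. (1) For all $\lambda\in\Sigma_{\pi-\epsilon}\cap\mathcal{B}_{\beta^4}(0)$, $$|F_n(\sqrt\lambda;\beta)|\ \ge\ \frac{c}{\beta}\,|\lambda|^{-\frac{\mathrm{Re}(\mu_n)}{2}}\,\min\{1,\,-\beta^2\log|\lambda|\}.$$ (2) For all $\lambda\in\Sigma_{\pi-\epsilon}\cap\mathcal{B}_{e^{-1/(6\beta)}}(0)$, $$\frac{1}{|F_n(\sqrt\lambda;\beta)|}\ \le\ C\,|\lambda|^{\frac{\mathrm{Re}(\mu_n)}{2}}.$$ (3) $F_n(\sqrt\lambda;\beta)\neq0$ for every $\lambda\in\mathbb{C}\setminus(-\infty,0]$ with $|\lambda|<e^{-\frac{1}{6\beta}}$. -/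

import Mathlib

noncomputable section

/-- The sector `Σ_φ = {z ∈ ℂ \ {0} : |arg z| < φ}`, with the principal argument. -/
def sector (φ : ℝ) : Set ℂ := {z : ℂ | z ≠ 0 ∧ |Complex.arg z| < φ}

/-- The modified Bessel function of the first kind
`I_μ(z) = (z/2)^μ ∑_{m ≥ 0} (z/2)^{2m} / (m! Γ(μ+m+1))`, `z ∈ ℂ \ (-∞, 0]`, with
`z^μ = exp (μ Log z)` for the principal logarithm. At the poles of `Γ` the library value
`Γ = 0` gives `1/Γ = 0`, which is the value of the entire function `1/Γ` there. -/
def besselI (μ z : ℂ) : ℂ :=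
  (z / 2) ^ μ *
    ∑' m : ℕ, 1 / ((m.factorial : ℂ) * Complex.Gamma (μ + m + 1)) * (z / 2) ^ (2 * m)

/-- The modified Bessel function of the second kind, of non-integer order `μ`:
`K_μ(z) = (π/2) (I_{-μ}(z) - I_μ(z)) / sin (μπ)`, `z ∈ ℂ \ (-∞, 0]`. -/
def besselK (μ z : ℂ) : ℂ :=
  (Real.pi : ℂ) / 2 * ((besselI (-μ) z - besselI μ z) / Complex.sin (μ * Real.pi))

/-- `μ_n(β) = (n² + inβ)^{1/2}`, the principal square root, which has positive real part for `n ≠ 0`. -/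
def besselOrder (n : ℤ) (β : ℝ) : ℂ :=
  Complex.sqrt ((n : ℂ) ^ 2 + Complex.I * (n : ℂ) * (β : ℂ))

/-- `F_n(z; β) = ∫_1^∞ s^{1-|n|} K_{μ_n(β)}(z s) ds`. -/
def besselF (n : ℤ) (z : ℂ) (β : ℝ) : ℂ :=
  ∫ s in Set.Ioi (1 : ℝ), (s : ℂ) ^ (1 - |n|) * besselK (besselOrder n β) (z * (s : ℂ))

/-- The set of zeros of `w ↦ F_n(√w; β)` in `ℂ \ (-∞, 0]`, with the principal square root. -/
def zerosF (n : ℤ) (β : ℝ) : Set ℂ :=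
  {w : ℂ | w ∈ Complex.slitPlane ∧ besselF n (Complex.sqrt w) β = 0}

end

open MeasureTheory Set Filter Topology

/-!
Write `z = √lam` and `μ_n = 1 + ν`, so that `2ν + ν² = i n β`: the imaginary part of `ν` has size
about `β / 2` and its real part is positive, of size about `β² / 8`. For `Re z > 0` and small `z`,
uniformly up to the imaginary axis,
`ν z F = Γ(1+ν) (z/2)^(-ν) - ν M(ν) + O(|z|)`, with `M(ν) = ∫_0^∞ v^(ν-1)/(v²+1) dv`
(`exists_norm_mul_integral_besselK_sub_le`), and `F` can only be small where the two main terms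
nearly cancel.

The asymptotic formula needs the decay of `K_μ` at infinity, which its definition by the growing
functions `I_{±μ}` hides. It comes from Schläfli's integral
`K_μ(z) = ½ ∫_1^∞ (v^(μ-1) + v^(-μ-1)) e^(-(z/2)(v + 1/v)) dv` (`besselK_eq_schlafliHalf`). With
`a = z/2`, expanding `e^(-a/v)` reduces each half to the integrals
`∫_1^∞ v^(s-1) e^(-a v) dv = a^(-s) Γ(s) - ∑_j (-a)^j / (j! (s+j))` (`upperExpIntegral_eq`). The
Gamma terms sum to the series of `I_{-μ}` and `I_μ` by the reflection formula, and the remaining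
double series of the two halves cancel on exchanging the summation indices.

Integrating Schläfli's formula along the ray from `z s` gives `2 K_ν(z s) - M(ν) + o(1)` as `s → 0`
(`tendsto_mul_integral_besselK_sub`), where `K_ν` carries the divergent power of `s`. On the segment
from `z s` to `z` the integrand is its singular part plus a remainder bounded by a multiple of
`1/|ν|`, so that the divergent powers cancel in the limit.

Finally `Γ(1+ν) (z/2)^(-ν) = ν M(ν) e^w` with `w = ν (log 2 - γ - log z) + O(ν²)`
(`exists_Gamma_mul_cpow_eq`). Put `X = log 2 - γ - log |z|`. Since `log 2 - γ` is real,
`Re w ≈ X Re ν + (Im ν) arg z` and `Im w ≈ X Im ν`. If `Re w` is at least `(X Re ν)/4`, then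
`|e^w - 1|` is bounded below through the modulus of `e^w`. Otherwise `|arg z| ≤ π/2` forces
`X |Im ν| < 3π/2`, so `w` stays away from the nonzero multiples of `2πi`, and the argument of `e^w`
gives the bound (`norm_exp_sub_one_ge`). Nothing here uses distance from the negative real axis, so
the lower bound holds on the whole slit plane, and the other two claims follow from it, as
`β² log (1/|lam|) ≥ β / 6` when `|lam| < e^(-1/(6β))`.
-/

/-! ### Gamma integrals along rotated rays -/

lemma integrableOn_rpow_mul_exp_Ioi_one (p : ℝ) {b : ℝ} (hb : 0 < b) :
    IntegrableOn (fun v : ℝ => v ^ p * Real.exp (-(b * v))) (Ioi 1) := by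
  have h := (integrableOn_rpow_mul_exp_neg_mul_rpow (p := 1) (s := |p|) (b := b)
    (by linarith [abs_nonneg p]) one_pos hb).mono_set (Ioi_subset_Ioi zero_le_one)
  refine Integrable.mono' h ?_ ?_
  · exact (by fun_prop : Measurable fun v : ℝ => v ^ p * Real.exp (-(b * v))).aestronglyMeasurable
  · refine (ae_restrict_iff' measurableSet_Ioi).2 (ae_of_all _ fun v hv => ?_)
    have hv1 : (1 : ℝ) ≤ v := le_of_lt hv
    rw [Real.norm_of_nonneg (by positivity), Real.rpow_one, neg_mul]
    gcongr
    exact le_abs_self p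

lemma norm_cpow_mul_cexp {v : ℝ} (hv : 0 < v) (s a : ℂ) :
    ‖(v : ℂ) ^ s * Complex.exp (-(a * v))‖ = v ^ s.re * Real.exp (-(a.re * v)) := by
  rw [norm_mul, Complex.norm_cpow_eq_rpow_re_of_pos hv, Complex.norm_exp]
  simp

lemma integrableOn_cpow_mul_cexp_Ioi_one (s : ℂ) {a : ℂ} (ha : 0 < a.re) :
    IntegrableOn (fun v : ℝ => (v : ℂ) ^ s * Complex.exp (-(a * v))) (Ioi 1) := by
  refine Integrable.mono' (integrableOn_rpow_mul_exp_Ioi_one s.re ha) ?_ ?_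
  · exact (by fun_prop : Measurable fun v : ℝ =>
      (v : ℂ) ^ s * Complex.exp (-(a * v))).aestronglyMeasurable
  · refine (ae_restrict_iff' measurableSet_Ioi).2 (ae_of_all _ fun v hv => ?_)
    rw [norm_cpow_mul_cexp (zero_lt_one.trans hv)]

lemma integrableOn_rpow_mul_exp_Ioi_zero {p b : ℝ} (hp : -1 < p) (hb : 0 < b) :
    IntegrableOn (fun v : ℝ => v ^ p * Real.exp (-(b * v))) (Ioi 0) := by
  have h := integrableOn_rpow_mul_exp_neg_mul_rpow (p := 1) (s := p) (b := b) hp one_pos hb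
  simpa using h

lemma integrableOn_cpow_mul_cexp_Ioi_zero {s a : ℂ} (hs : -1 < s.re) (ha : 0 < a.re) :
    IntegrableOn (fun v : ℝ => (v : ℂ) ^ s * Complex.exp (-(a * v))) (Ioi 0) := by
  refine Integrable.mono' (integrableOn_rpow_mul_exp_Ioi_zero hs ha) ?_ ?_
  · exact (by fun_prop : Measurable fun v : ℝ =>
      (v : ℂ) ^ s * Complex.exp (-(a * v))).aestronglyMeasurable
  · refine (ae_restrict_iff' measurableSet_Ioi).2 (ae_of_all _ fun v hv => ?_)
    rw [norm_cpow_mul_cexp hv]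

lemma differentiableOn_integral_cpow_mul_cexp {s : ℂ} (hs : 0 < s.re) :
    DifferentiableOn ℂ (fun a : ℂ => ∫ v in Ioi (0 : ℝ), (v : ℂ) ^ (s - 1) * Complex.exp (-(a * v)))
      {a : ℂ | 0 < a.re} := by
  intro a₀ ha₀
  have ha₀' : 0 < a₀.re := ha₀
  have hsub : -1 < (s - 1).re := by simpa using hs
  refine (hasDerivAt_integral_of_dominated_loc_of_deriv_le (μ := volume.restrict (Ioi (0:ℝ)))
    (F := fun (a : ℂ) (v : ℝ) => (v : ℂ) ^ (s - 1) * Complex.exp (-(a * v)))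
    (F' := fun a v => (v : ℂ) ^ (s - 1) * (Complex.exp (-(a * v)) * (-v)))
    (bound := fun v : ℝ => v ^ s.re * Real.exp (-(a₀.re / 2 * v)))
    (Metric.ball_mem_nhds a₀ (half_pos ha₀')) ?_
    (integrableOn_cpow_mul_cexp_Ioi_zero hsub ha₀) ?_ ?_
    (integrableOn_rpow_mul_exp_Ioi_zero (by linarith) (half_pos ha₀'))
    ?_).2.differentiableAt.differentiableWithinAt
  · exact Eventually.of_forall fun a => (by fun_prop : Measurable fun v : ℝ =>
      (v : ℂ) ^ (s - 1) * Complex.exp (-(a * v))).aestronglyMeasurable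
  · exact (by fun_prop : Measurable fun v : ℝ =>
      (v : ℂ) ^ (s - 1) * (Complex.exp (-(a₀ * v)) * (-v))).aestronglyMeasurable
  · refine (ae_restrict_iff' measurableSet_Ioi).2 (ae_of_all _ fun v hv a ha => ?_)
    have hv' : (0 : ℝ) < v := hv
    rw [← mul_assoc, norm_mul, norm_cpow_mul_cexp hv', norm_neg, Complex.norm_real,
      Real.norm_of_nonneg hv'.le, mul_right_comm]
    have h1 : v ^ (s - 1).re * v = v ^ s.re := by
      rw [← Real.rpow_add_one hv'.ne']; simp
    rw [h1]
    have h2 : a₀.re / 2 ≤ a.re := by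
      have := (Complex.abs_re_le_norm (a - a₀)).trans (mem_ball_iff_norm.1 ha).le
      rw [Complex.sub_re] at this
      linarith [(abs_le.1 this).1]
    gcongr
  · refine ae_of_all _ fun v a _ => ?_
    have h : HasDerivAt (fun a : ℂ => -(a * v)) (-(v : ℂ)) a := by
      simpa using ((hasDerivAt_id a).mul_const (v : ℂ)).fun_neg
    exact h.cexp.const_mul _

/-- Euler's integral for `Γ` along a rotated ray, obtained from the real case by the identity
theorem. -/
lemma integral_cpow_mul_cexp_Ioi_zero {s a : ℂ} (hs : 0 < s.re) (ha : 0 < a.re) :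
    ∫ v in Ioi (0 : ℝ), (v : ℂ) ^ (s - 1) * Complex.exp (-(a * v))
      = (1 / a) ^ s * Complex.Gamma s := by
  have hopen : IsOpen {a : ℂ | 0 < a.re} := isOpen_lt continuous_const Complex.continuous_re
  have hconn : IsPreconnected {a : ℂ | 0 < a.re} := (convex_halfSpace_re_gt 0).isPreconnected
  have hd : DifferentiableOn ℂ (fun a : ℂ => (1 / a) ^ s * Complex.Gamma s) {a : ℂ | 0 < a.re} := by
    intro a ha
    have ha0 : a ≠ 0 := by rintro rfl; simp at ha
    have hi : 1 / a ∈ Complex.slitPlane := by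
      left
      rw [one_div, Complex.inv_re]
      exact div_pos ha (Complex.normSq_pos.2 ha0)
    refine DifferentiableAt.differentiableWithinAt ?_
    refine DifferentiableAt.mul_const ?_ _
    refine DifferentiableAt.cpow ?_ (differentiableAt_const _) hi
    exact (differentiableAt_const _).div differentiableAt_id ha0
  refine (((differentiableOn_integral_cpow_mul_cexp hs).analyticOnNhd hopen)
    |>.eqOn_of_preconnected_of_frequently_eq (hd.analyticOnNhd hopen) hconn
    (z₀ := 1) (by simp) ?_) ha
  have ht : Tendsto (fun x : ℝ => (x : ℂ)) (𝓝[≠] 1) (𝓝[≠] 1) := by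
    refine tendsto_nhdsWithin_iff.2 ⟨?_, ?_⟩
    · exact (Complex.continuous_ofReal.tendsto' 1 1 (by simp)).mono_left nhdsWithin_le_nhds
    · filter_upwards [self_mem_nhdsWithin] with x hx
      simpa using hx
  refine ht.frequently (Eventually.frequently ?_)
  have : ∀ᶠ x : ℝ in 𝓝[≠] 1, 0 < x := nhdsWithin_le_nhds (lt_mem_nhds one_pos)
  filter_upwards [this] with x hx
  exact Complex.integral_cpow_mul_exp_neg_mul_Ioi hs hx

/-! ### The incomplete Gamma connection formula -/

lemma abs_im_le_norm_add_real (s : ℂ) (x : ℝ) : |s.im| ≤ ‖s + x‖ := by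
  simpa using Complex.abs_im_le_norm (s + x)

/-- Orders with nonzero imaginary part stay at distance `|Im s|` from the integers, which keeps the
denominators away from zero uniformly in `j`. -/
lemma summable_pow_div_factorial_div_add {s : ℂ} (hs : s.im ≠ 0) (a : ℂ) :
    Summable fun j : ℕ => (-a) ^ j / (j.factorial : ℂ) / (s + j) := by
  refine Summable.of_norm_bounded
    ((Real.summable_pow_div_factorial ‖a‖).mul_right |s.im|⁻¹) fun j => ?_
  rw [norm_div, norm_div, norm_pow, norm_neg, Complex.norm_natCast, div_eq_mul_inv _ ‖s + j‖]
  have h := abs_im_le_norm_add_real s j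
  have h0 : 0 < |s.im| := abs_pos.2 hs
  push_cast at h
  gcongr

/-- The incomplete Gamma-type integral `∫_1^∞ v^(s-1) e^(-a v) dv`. -/
noncomputable def upperExpIntegral (s a : ℂ) : ℂ :=
  ∫ v in Ioi (1 : ℝ), (v : ℂ) ^ (s - 1) * Complex.exp (-(a * v))

/-- The series `∑_j (-a)^j / (j! (s + j))`, which is `∫_0^1 v^(s-1) e^(-a v) dv` for `Re s > 0`. -/
noncomputable def lowerExpSeries (s a : ℂ) : ℂ := ∑' j : ℕ, (-a) ^ j / (j.factorial : ℂ) / (s + j)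

lemma integrableOn_cpow_Ioc_zero_one {s : ℂ} (hs : 0 < s.re) :
    IntegrableOn (fun v : ℝ => (v : ℂ) ^ (s - 1)) (Ioc 0 1) :=
  (intervalIntegrable_iff_integrableOn_Ioc_of_le zero_le_one).1
    (intervalIntegral.intervalIntegrable_cpow' (by simpa using hs))

lemma integral_cpow_Ioc_zero_one {s : ℂ} (hs : 0 < s.re) :
    ∫ v in Ioc (0 : ℝ) 1, (v : ℂ) ^ (s - 1) = 1 / s := by
  rw [← intervalIntegral.integral_of_le zero_le_one, integral_cpow (Or.inl (by simpa using hs))]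
  have h0 : s ≠ 0 := by rintro rfl; simp at hs
  simp [h0]

lemma integral_lower_eq_lowerExpSeries {s : ℂ} (hs : 0 < s.re) (a : ℂ) :
    ∫ v in Ioc (0 : ℝ) 1, (v : ℂ) ^ (s - 1) * Complex.exp (-(a * v)) = lowerExpSeries s a := by
  have hre (j : ℕ) : 0 < (s + j).re := by simp; positivity
  have key : ∀ j : ℕ, ∀ v ∈ Ioc (0 : ℝ) 1,
      (v : ℂ) ^ (s - 1) * ((-a * v) ^ j / (j.factorial : ℂ))
        = (-a) ^ j / (j.factorial : ℂ) * (v : ℂ) ^ (s + j - 1) := by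
    intro j v hv
    have hv0 : (v : ℂ) ≠ 0 := by exact_mod_cast hv.1.ne'
    rw [show s + j - 1 = (s - 1) + j by ring, Complex.cpow_add _ _ hv0, Complex.cpow_natCast]
    ring
  have hint (j : ℕ) : IntegrableOn (fun v : ℝ => (v : ℂ) ^ (s - 1) *
      ((-a * v) ^ j / (j.factorial : ℂ))) (Ioc 0 1) :=
    IntegrableOn.congr_fun ((integrableOn_cpow_Ioc_zero_one (hre j)).const_mul _)
      (fun v hv => (key j v hv).symm) measurableSet_Ioc
  have hsum : Summable fun j : ℕ => ∫ v in Ioc (0 : ℝ) 1,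
      ‖(v : ℂ) ^ (s - 1) * ((-a * v) ^ j / (j.factorial : ℂ))‖ := by
    refine Summable.of_nonneg_of_le (fun j => integral_nonneg fun v => norm_nonneg _)
      (fun j => ?_) ((Real.summable_pow_div_factorial ‖a‖).mul_right
        (∫ v in Ioc (0 : ℝ) 1, ‖(v : ℂ) ^ (s - 1)‖))
    rw [← integral_const_mul]
    refine setIntegral_mono_on (hint j).norm
      ((integrableOn_cpow_Ioc_zero_one hs).norm.const_mul _) measurableSet_Ioc fun v hv => ?_
    rw [norm_mul, mul_comm, norm_div, norm_pow, norm_mul, norm_neg, Complex.norm_natCast,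
      Complex.norm_real, Real.norm_of_nonneg hv.1.le]
    have hv0 := hv.1.le
    gcongr
    exact mul_le_of_le_one_right (norm_nonneg _) hv.2
  have h := hasSum_integral_of_summable_integral_norm hint hsum
  have hexp : ∀ v : ℝ, ∑' j : ℕ, (v : ℂ) ^ (s - 1) * ((-a * v) ^ j / (j.factorial : ℂ))
      = (v : ℂ) ^ (s - 1) * Complex.exp (-(a * v)) := by
    intro v
    rw [tsum_mul_left, Complex.exp_eq_exp_ℂ, NormedSpace.exp_eq_tsum_div, neg_mul]
  simp_rw [hexp] at h
  rw [← h.tsum_eq, lowerExpSeries]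
  refine tsum_congr fun j => ?_
  rw [setIntegral_congr_fun measurableSet_Ioc (key j), integral_const_mul,
    integral_cpow_Ioc_zero_one (hre j)]
  ring

lemma tendsto_cpow_mul_cexp_atTop (s : ℂ) {a : ℂ} (ha : 0 < a.re) :
    Tendsto (fun v : ℝ => (v : ℂ) ^ s * Complex.exp (-(a * v))) atTop (𝓝 0) := by
  rw [tendsto_zero_iff_norm_tendsto_zero]
  have h := tendsto_rpow_mul_exp_neg_mul_atTop_nhds_zero s.re a.re ha
  refine h.congr' ?_
  filter_upwards [eventually_gt_atTop 0] with v hv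
  rw [norm_cpow_mul_cexp hv, neg_mul]

/-- Integration by parts: `s E(s) = a E(s+1) - e^{-a}`. -/
lemma mul_upperExpIntegral (s : ℂ) {a : ℂ} (ha : 0 < a.re) :
    s * upperExpIntegral s a = a * upperExpIntegral (s + 1) a - Complex.exp (-a) := by
  have h1 := (integrableOn_cpow_mul_cexp_Ioi_one (s - 1) ha).const_mul s
  have h2 := (integrableOn_cpow_mul_cexp_Ioi_one s ha).const_mul a
  have hd : ∀ v ∈ Ici (1 : ℝ), HasDerivAt (fun v : ℝ => (v : ℂ) ^ s * Complex.exp (-(a * v)))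
      (s * ((v : ℂ) ^ (s - 1) * Complex.exp (-(a * v)))
        - a * ((v : ℂ) ^ s * Complex.exp (-(a * v)))) v := by
    intro v hv
    have hv0 : (0 : ℝ) < v := zero_lt_one.trans_le hv
    have e1 : HasDerivAt (fun v : ℝ => (v : ℂ) ^ s) (s * (v : ℂ) ^ (s - 1)) v := by
      simpa using (hasDerivAt_id (v : ℂ)).cpow_const (c := s) (Or.inl (by simpa using hv0))
        |>.comp_ofReal
    have e2 : HasDerivAt (fun v : ℝ => Complex.exp (-(a * v)))
        (Complex.exp (-(a * v)) * (-(a * 1))) v := by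
      have : HasDerivAt (fun w : ℂ => -(a * w)) (-(a * 1)) (v : ℂ) :=
        ((hasDerivAt_id (v : ℂ)).const_mul a).fun_neg
      exact this.cexp.comp_ofReal
    refine (e1.mul e2).congr_deriv ?_
    ring
  have h := integral_Ioi_of_hasDerivAt_of_tendsto' hd (h1.sub h2)
    (tendsto_cpow_mul_cexp_atTop s ha)
  rw [integral_sub h1 h2, integral_const_mul, integral_const_mul] at h
  rw [upperExpIntegral, upperExpIntegral, add_sub_cancel_right]
  simp only [Complex.ofReal_one, Complex.one_cpow, mul_one, one_mul] at h
  linear_combination h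

lemma mul_lowerExpSeries {s : ℂ} (hs : s.im ≠ 0) (a : ℂ) :
    s * lowerExpSeries s a = a * lowerExpSeries (s + 1) a + Complex.exp (-a) := by
  have h1 := summable_pow_div_factorial_div_add hs a
  have h2 : Summable fun j : ℕ => (-a) ^ j / (j.factorial : ℂ) / (s + 1 + j) :=
    summable_pow_div_factorial_div_add (s := s + 1) (by simpa using hs) a
  have h3 : Summable fun j : ℕ => (-a) ^ j / (j.factorial : ℂ) :=
    NormedSpace.expSeries_div_summable (𝔸 := ℂ) (-a)
  have hne (j : ℕ) : s + j ≠ 0 := by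
    intro h
    have := congrArg Complex.im h
    simp at this
    exact hs this
  have e3 : Complex.exp (-a) = ∑' j : ℕ, (-a) ^ j / (j.factorial : ℂ) := by
    rw [Complex.exp_eq_exp_ℂ, NormedSpace.exp_eq_tsum_div]
  -- the shifted sum equals `∑ j * (-a)^j / (j! (s + j))` up to sign
  have e4 : ∀ j : ℕ, (-a) ^ (j + 1) / ((j + 1).factorial : ℂ) * ((j + 1 : ℕ) / (s + (j + 1 : ℕ)))
      = -a * ((-a) ^ j / (j.factorial : ℂ) / (s + 1 + j)) := by
    intro j
    have h5 := hne (j + 1)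
    have h6 : (j.factorial : ℂ) ≠ 0 := by exact_mod_cast j.factorial_ne_zero
    have h7 : ((j : ℂ) + 1) ≠ 0 := by exact_mod_cast j.succ_ne_zero
    rw [Nat.factorial_succ, pow_succ]
    push_cast at h5 ⊢
    have h8 : s + 1 + j ≠ 0 := by rwa [add_assoc, add_comm (1 : ℂ)]
    field_simp
    ring
  have e5 : Summable fun j : ℕ => (-a) ^ j / (j.factorial : ℂ) * (j / (s + j)) := by
    rw [← summable_nat_add_iff 1]
    exact (h2.mul_left (-a)).congr fun j => (e4 j).symm
  have e6 : ∑' j : ℕ, (-a) ^ j / (j.factorial : ℂ) * (j / (s + j))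
      = -a * lowerExpSeries (s + 1) a := by
    rw [e5.tsum_eq_zero_add, lowerExpSeries, ← tsum_mul_left]
    simp only [e4]
    simp
  have e7 : ∑' j : ℕ, (-a) ^ j / (j.factorial : ℂ)
      = s * lowerExpSeries s a + ∑' j : ℕ, (-a) ^ j / (j.factorial : ℂ) * (j / (s + j)) := by
    rw [lowerExpSeries, ← tsum_mul_left, ← (h1.mul_left s).tsum_add e5]
    refine tsum_congr fun j => ?_
    have := hne j
    field_simp
  rw [e3, e7, e6]
  ring

/-- The connection formula `∫_1^∞ v^(s-1) e^(-a v) dv = a^(-s) Γ(s) - ∑_j (-a)^j / (j! (s + j))`.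
For `Re s > 0` it is Euler's integral cut at `1`; the recurrences of both sides in `s` carry it to
the left. -/
lemma upperExpIntegral_eq {s a : ℂ} (hs : s.im ≠ 0) (ha : 0 < a.re) :
    upperExpIntegral s a = (1 / a) ^ s * Complex.Gamma s - lowerExpSeries s a := by
  have ha0 : a ≠ 0 := by rintro rfl; simp at ha
  have main : ∀ N : ℕ, ∀ s : ℂ, s.im ≠ 0 → -(N : ℝ) < s.re →
      upperExpIntegral s a = (1 / a) ^ s * Complex.Gamma s - lowerExpSeries s a := by
    intro N
    induction N with
    | zero =>
      intro s _ hre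
      have hre' : 0 < s.re := by simpa using hre
      have hi := integrableOn_cpow_mul_cexp_Ioi_zero (s := s - 1) (by simpa using hre') ha
      rw [← integral_cpow_mul_cexp_Ioi_zero hre' ha, ← integral_lower_eq_lowerExpSeries hre',
        ← Ioc_union_Ioi_eq_Ioi zero_le_one, setIntegral_union (Ioc_disjoint_Ioi le_rfl)
          measurableSet_Ioi (hi.mono_set Ioc_subset_Ioi_self)
          (hi.mono_set (Ioi_subset_Ioi zero_le_one)), upperExpIntegral]
      ring
    | succ N ih =>
      intro s him hre
      have h := ih (s + 1) (by simpa using him) (by push_cast at hre; simp; linarith)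
      have h0 : s ≠ 0 := by rintro rfl; simp at him
      refine mul_left_cancel₀ h0 ?_
      rw [mul_upperExpIntegral s ha, h, mul_sub s, mul_sub a, mul_lowerExpSeries him,
        Complex.Gamma_add_one s h0, Complex.cpow_add _ _ (one_div_ne_zero ha0), Complex.cpow_one]
      field_simp
      ring
  obtain ⟨N, hN⟩ := exists_nat_gt (-s.re)
  exact main N s hs (by linarith)

/-! ### Schläfli's integral for `K_μ` -/

/-- The half-line integral `∫_1^∞ v^(μ-1) e^(-a (v + 1/v)) dv`. -/
noncomputable def schlafliHalf (μ a : ℂ) : ℂ :=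
  ∫ v in Ioi (1 : ℝ), (v : ℂ) ^ (μ - 1) * Complex.exp (-(a * (v + 1 / v)))

lemma hasSum_schlafliHalf (μ : ℂ) {a : ℂ} (ha : 0 < a.re) :
    HasSum (fun k : ℕ => (-a) ^ k / (k.factorial : ℂ) * upperExpIntegral (μ - k) a)
      (schlafliHalf μ a) := by
  have key : ∀ k : ℕ, ∀ v ∈ Ioi (1 : ℝ),
      (v : ℂ) ^ (μ - 1) * Complex.exp (-(a * v)) * ((-a / v) ^ k / (k.factorial : ℂ))
        = (-a) ^ k / (k.factorial : ℂ) * ((v : ℂ) ^ (μ - k - 1) * Complex.exp (-(a * v))) := by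
    intro k v hv
    have hv0 : (v : ℂ) ≠ 0 := by exact_mod_cast (zero_lt_one.trans hv).ne'
    rw [show μ - k - 1 = (μ - 1) - k by ring, Complex.cpow_sub (μ - 1) _ hv0, Complex.cpow_natCast]
    ring
  have hint (k : ℕ) : IntegrableOn (fun v : ℝ => (v : ℂ) ^ (μ - 1) * Complex.exp (-(a * v)) *
      ((-a / v) ^ k / (k.factorial : ℂ))) (Ioi 1) :=
    IntegrableOn.congr_fun ((integrableOn_cpow_mul_cexp_Ioi_one (μ - k - 1) ha).const_mul _)
      (fun v hv => (key k v hv).symm) measurableSet_Ioi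
  have hsum : Summable fun k : ℕ => ∫ v in Ioi (1 : ℝ),
      ‖(v : ℂ) ^ (μ - 1) * Complex.exp (-(a * v)) * ((-a / v) ^ k / (k.factorial : ℂ))‖ := by
    refine Summable.of_nonneg_of_le (fun j => integral_nonneg fun v => norm_nonneg _)
      (fun k => ?_) ((Real.summable_pow_div_factorial ‖a‖).mul_right
        (∫ v in Ioi (1 : ℝ), ‖(v : ℂ) ^ (μ - 1) * Complex.exp (-(a * v))‖))
    rw [← integral_const_mul]
    refine setIntegral_mono_on (hint k).norm
      ((integrableOn_cpow_mul_cexp_Ioi_one (μ - 1) ha).norm.const_mul _) measurableSet_Ioi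
      fun v hv => ?_
    have hv1 : (1 : ℝ) ≤ v := le_of_lt hv
    rw [norm_mul, mul_comm, norm_div ((-a / v) ^ k), norm_pow, norm_div, norm_neg,
      Complex.norm_natCast, Complex.norm_real, Real.norm_of_nonneg (zero_le_one.trans hv1)]
    gcongr
    exact div_le_self (norm_nonneg _) hv1
  have h := hasSum_integral_of_summable_integral_norm hint hsum
  have hexp : ∀ v : ℝ, ∑' k : ℕ, (v : ℂ) ^ (μ - 1) * Complex.exp (-(a * v)) *
      ((-a / v) ^ k / (k.factorial : ℂ)) = (v : ℂ) ^ (μ - 1) * Complex.exp (-(a * (v + 1 / v))) := by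
    intro v
    have h1 : ∑' k : ℕ, (-a / v) ^ k / (k.factorial : ℂ) = Complex.exp (-a / v) := by
      rw [Complex.exp_eq_exp_ℂ, NormedSpace.exp_eq_tsum_div]
    rw [tsum_mul_left, h1, mul_assoc, ← Complex.exp_add]
    congr 2
    ring
  simp_rw [hexp] at h
  refine h.congr_fun fun k => ?_
  rw [setIntegral_congr_fun measurableSet_Ioi (key k), integral_const_mul, upperExpIntegral]

lemma summable_double_exp_series {μ : ℂ} (hμ : μ.im ≠ 0) (a : ℂ) :
    Summable fun p : ℕ × ℕ => (-a) ^ p.1 / (p.1.factorial : ℂ) *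
      ((-a) ^ p.2 / (p.2.factorial : ℂ) / (μ - p.1 + p.2)) := by
  have h0 : 0 < |μ.im| := abs_pos.2 hμ
  refine Summable.of_norm_bounded
    (((Real.summable_pow_div_factorial ‖a‖).mul_of_nonneg (Real.summable_pow_div_factorial ‖a‖)
      (fun k => by positivity) (fun k => by positivity)).mul_right |μ.im|⁻¹) fun p => ?_
  have h := abs_im_le_norm_add_real μ ((p.2 : ℝ) - p.1)
  push_cast at h
  rw [show μ + ((p.2 : ℂ) - p.1) = μ - p.1 + p.2 by ring] at h
  simp only [norm_mul, norm_div, norm_pow, norm_neg, Complex.norm_natCast]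
  rw [div_eq_mul_inv (‖a‖ ^ p.2 / (p.2.factorial : ℝ)), ← mul_assoc]
  gcongr

/-- Exchanging the two summation indices reverses the sign of the order. -/
lemma tsum_double_exp_series_neg (μ a : ℂ) :
    ∑' p : ℕ × ℕ, (-a) ^ p.1 / (p.1.factorial : ℂ) *
        ((-a) ^ p.2 / (p.2.factorial : ℂ) / (-μ - p.1 + p.2))
      = -∑' p : ℕ × ℕ, (-a) ^ p.1 / (p.1.factorial : ℂ) *
        ((-a) ^ p.2 / (p.2.factorial : ℂ) / (μ - p.1 + p.2)) := by
  rw [← tsum_neg, ← (Equiv.prodComm ℕ ℕ).tsum_eq]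
  refine tsum_congr fun p => ?_
  simp only [Equiv.prodComm_apply, Prod.fst_swap, Prod.snd_swap]
  rw [show -μ - (p.2 : ℂ) + p.1 = -(μ - p.1 + p.2) by ring, div_neg]
  ring

lemma gamma_sub_nat_term {μ : ℂ} (hμ : μ.im ≠ 0) {a : ℂ} (ha : 0 < a.re) (k : ℕ) :
    (-a) ^ k / (k.factorial : ℂ) * ((1 / a) ^ (μ - k) * Complex.Gamma (μ - k))
      = Real.pi / Complex.sin (μ * Real.pi) * (a ^ (-μ) *
        (1 / ((k.factorial : ℂ) * Complex.Gamma (-μ + k + 1)) * a ^ (2 * k))) := by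
  have ha0 : a ≠ 0 := by rintro rfl; simp at ha
  have harg : a.arg ≠ Real.pi := fun h => by
    rw [Complex.arg_eq_pi_iff] at h
    linarith [h.1]
  have hG : Complex.Gamma (-μ + k + 1) ≠ 0 := by
    refine Complex.Gamma_ne_zero fun m h => hμ ?_
    have := congrArg Complex.im h
    simpa using this
  have hrefl := Complex.Gamma_mul_Gamma_one_sub (μ - k)
  rw [show 1 - (μ - (k : ℂ)) = -μ + k + 1 by ring,
    show (Real.pi : ℂ) * (μ - k) = μ * Real.pi - k * Real.pi by ring,
    Complex.sin_antiperiodic.sub_nat_mul_eq] at hrefl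
  have hG2 : Complex.Gamma (μ - k)
      = (-1) ^ k * (Real.pi / Complex.sin (μ * Real.pi)) / Complex.Gamma (-μ + k + 1) := by
    rw [eq_div_iff hG, hrefl]
    rcases neg_one_pow_eq_or ℂ k with h | h <;> rw [h] <;> simp [div_neg]
  rw [hG2, one_div, Complex.inv_cpow _ _ harg, Complex.cpow_sub _ _ ha0, Complex.cpow_natCast,
    Complex.cpow_neg, neg_pow a k,
    inv_div]
  have h2 : ((-1 : ℂ) ^ k) * (-1) ^ k = 1 := by rw [← mul_pow]; simp
  linear_combination (Real.pi / Complex.sin (μ * Real.pi) * (a ^ μ)⁻¹ * a ^ (2 * k) /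
    (k.factorial : ℂ) / Complex.Gamma (-μ + k + 1)) * h2

/-- The half integral is a multiple of `I_{-μ}` up to a double series that is odd in `μ`. -/
lemma besselI_neg_eq {μ z : ℂ} (hμ : μ.im ≠ 0) (hz : 0 < z.re) :
    Real.pi / Complex.sin (μ * Real.pi) * besselI (-μ) z
      = schlafliHalf μ (z / 2) + ∑' p : ℕ × ℕ, (-(z / 2)) ^ p.1 / (p.1.factorial : ℂ) *
        ((-(z / 2)) ^ p.2 / (p.2.factorial : ℂ) / (μ - p.1 + p.2)) := by
  set a := z / 2 with ha_def
  have ha : 0 < a.re := by simp [ha_def, hz]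
  have h1 := hasSum_schlafliHalf μ ha
  have h2 := (summable_double_exp_series hμ a).hasSum.prod_fiberwise (fun k =>
    ((summable_pow_div_factorial_div_add (s := μ - k) (by simpa using hμ) a).hasSum.mul_left
      ((-a) ^ k / (k.factorial : ℂ))))
  rw [← (h1.add h2).tsum_eq, besselI, ← tsum_mul_left, ← tsum_mul_left]
  refine tsum_congr fun k => ?_
  rw [upperExpIntegral_eq (by simpa using hμ) ha, ← gamma_sub_nat_term hμ ha k, lowerExpSeries]
  ring

/-- Schläfli's integral `K_μ(z) = ½ ∫_0^∞ v^(μ-1) e^(-(z/2)(v + 1/v)) dv`, folded onto `(1, ∞)`. -/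
lemma besselK_eq_schlafliHalf {μ z : ℂ} (hμ : μ.im ≠ 0) (hz : 0 < z.re) :
    besselK μ z = 1 / 2 * (schlafliHalf μ (z / 2) + schlafliHalf (-μ) (z / 2)) := by
  have h1 := besselI_neg_eq hμ hz
  have h2 := besselI_neg_eq (μ := -μ) (by simpa using hμ) hz
  rw [tsum_double_exp_series_neg, neg_mul, Complex.sin_neg, neg_neg, div_neg] at h2
  rw [besselK]
  linear_combination (1 / 2) * h1 + (1 / 2) * h2

/-! ### The integral of `K_{1+ν}` along a ray -/

lemma integrableOn_schlafli_kernel (μ : ℂ) {a : ℂ} (ha : 0 < a.re) :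
    IntegrableOn (fun v : ℝ => (v : ℂ) ^ (μ - 1) * Complex.exp (-(a * (v + 1 / v)))) (Ioi 1) := by
  refine Integrable.mono' (integrableOn_rpow_mul_exp_Ioi_one (μ - 1).re ha) ?_ ?_
  · exact (by fun_prop : Measurable fun v : ℝ =>
      (v : ℂ) ^ (μ - 1) * Complex.exp (-(a * (v + 1 / v)))).aestronglyMeasurable
  · refine (ae_restrict_iff' measurableSet_Ioi).2 (ae_of_all _ fun v hv => ?_)
    have hv0 : (0 : ℝ) < v := zero_lt_one.trans hv
    rw [norm_mul, Complex.norm_cpow_eq_rpow_re_of_pos hv0, Complex.norm_exp]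
    have e : (-(a * ((v : ℂ) + 1 / v))).re = -(a.re * (v + 1 / v)) := by
      rw [show (v : ℂ) + 1 / v = ((v + 1 / v : ℝ) : ℂ) by push_cast; rfl, Complex.neg_re,
        Complex.re_mul_ofReal]
    rw [e]
    gcongr
    have : 0 < 1 / v := by positivity
    linarith

/-- The density of Schläfli's integral for `K_μ` on `(1, ∞)`. -/
noncomputable def schlafliWeight (μ : ℂ) (v : ℝ) : ℂ :=
  1 / 2 * ((v : ℂ) ^ (μ - 1) + (v : ℂ) ^ (-μ - 1))

lemma measurable_schlafliWeight (μ : ℂ) : Measurable (schlafliWeight μ) := by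
  unfold schlafliWeight
  fun_prop

lemma integrableOn_schlafliWeight_mul_exp (μ : ℂ) {a : ℂ} (ha : 0 < a.re) :
    IntegrableOn (fun v : ℝ => schlafliWeight μ v * Complex.exp (-(a * (v + 1 / v)))) (Ioi 1) := by
  have h := ((integrableOn_schlafli_kernel μ ha).add
    (integrableOn_schlafli_kernel (-μ) ha)).const_mul (1 / 2)
  refine h.congr (ae_of_all _ fun v => ?_)
  simp only [schlafliWeight, Pi.add_apply]
  ring

lemma besselK_eq_integral {μ z : ℂ} (hμ : μ.im ≠ 0) (hz : 0 < z.re) :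
    besselK μ z
      = ∫ v in Ioi (1 : ℝ), schlafliWeight μ v * Complex.exp (-(z / 2 * (v + 1 / v))) := by
  have ha : 0 < (z / 2).re := by simp [hz]
  rw [besselK_eq_schlafliHalf hμ hz, schlafliHalf, schlafliHalf,
    ← integral_add (integrableOn_schlafli_kernel μ ha) (integrableOn_schlafli_kernel (-μ) ha),
    ← integral_const_mul]
  congr 1
  ext v
  rw [schlafliWeight]
  ring

lemma integrable_schlafli_prod (μ : ℂ) {z : ℂ} (hz : 0 < z.re) {s : ℝ} (hs : 0 < s) :
    Integrable (fun p : ℝ × ℝ => schlafliWeight μ p.2 *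
        Complex.exp (-(z * p.1 / 2 * (p.2 + 1 / p.2))))
      ((volume.restrict (Ioi s)).prod (volume.restrict (Ioi 1))) := by
  have h1 : IntegrableOn (fun t : ℝ => Real.exp (-(z.re / 2) * t)) (Ioi s) :=
    integrableOn_exp_mul_Ioi (by linarith) s
  have h2 := (integrableOn_schlafliWeight_mul_exp μ (a := ((z.re * s / 4 : ℝ) : ℂ))
    (by rw [Complex.ofReal_re]; positivity)).norm
  refine Integrable.mono' (h1.mul_prod h2) ?_ ?_
  · have := measurable_schlafliWeight μ
    exact (by fun_prop : Measurable fun p : ℝ × ℝ => schlafliWeight μ p.2 *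
      Complex.exp (-(z * p.1 / 2 * (p.2 + 1 / p.2)))).aestronglyMeasurable
  · rw [Measure.prod_restrict]
    refine (ae_restrict_iff' (measurableSet_Ioi.prod measurableSet_Ioi)).2
      (ae_of_all _ fun p hp => ?_)
    obtain ⟨t, v⟩ := p
    have ht : s < t := hp.1
    have hv : 1 < v := hp.2
    have hv0 : 0 < v := zero_lt_one.trans hv
    have e1 : (-(z * t / 2 * ((v : ℂ) + 1 / v))).re = -(z.re * (t * ((v + 1 / v) / 2))) := by
      rw [show -(z * t / 2 * ((v : ℂ) + 1 / v)) = -(z * ((t * ((v + 1 / v) / 2) : ℝ) : ℂ)) by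
        push_cast; ring, Complex.neg_re, Complex.re_mul_ofReal]
    have e2 : (-(((z.re * s / 4 : ℝ) : ℂ) * ((v : ℂ) + 1 / v))).re
        = -(z.re * s / 4 * (v + 1 / v)) := by
      rw [show (v : ℂ) + 1 / v = ((v + 1 / v : ℝ) : ℂ) by push_cast; rfl, ← Complex.ofReal_mul,
        Complex.neg_re, Complex.ofReal_re]
    simp only [norm_mul, Complex.norm_exp, e1, e2]
    rw [mul_left_comm (Real.exp _), ← Real.exp_add]
    gcongr
    -- `t c ≥ t/2 + s c/2` because `c = (v + 1/v)/2 ≥ 1` and `t ≥ s`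
    have hc : 1 ≤ (v + 1 / v) / 2 := by
      rw [le_div_iff₀ two_pos, one_mul, ← sub_nonneg]
      have : v + 1 / v - 2 = (v - 1) ^ 2 / v := by field_simp; ring
      rw [this]
      positivity
    generalize (v + 1 / v) = c at hc ⊢
    have h3 : t / 2 + s * c / 4 ≤ t * (c / 2) := by nlinarith
    nlinarith

lemma integrableOn_besselK {μ z : ℂ} (hμ : μ.im ≠ 0) (hz : 0 < z.re) {s : ℝ} (hs : 0 < s) :
    IntegrableOn (fun t : ℝ => besselK μ (z * t)) (Ioi s) := by
  refine IntegrableOn.congr_fun (integrable_schlafli_prod μ hz hs).integral_prod_left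
    (fun t ht => ?_) measurableSet_Ioi
  rw [besselK_eq_integral hμ]
  rw [Complex.re_mul_ofReal]
  exact mul_pos hz (hs.trans ht)

/-- Integrating Schläfli's formula along the ray through `z`. -/
lemma mul_integral_besselK {μ z : ℂ} (hμ : μ.im ≠ 0) (hz : 0 < z.re) {s : ℝ} (hs : 0 < s) :
    z * ∫ t in Ioi s, besselK μ (z * t)
      = ∫ v in Ioi (1 : ℝ), ((v : ℂ) ^ μ + (v : ℂ) ^ (-μ)) / (v ^ 2 + 1) *
          Complex.exp (-(z * s / 2 * (v + 1 / v))) := by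
  have h1 : ∫ t in Ioi s, besselK μ (z * t) = ∫ t in Ioi s, ∫ v in Ioi (1 : ℝ),
      schlafliWeight μ v * Complex.exp (-(z * t / 2 * (v + 1 / v))) := by
    refine setIntegral_congr_fun measurableSet_Ioi fun t ht => besselK_eq_integral hμ ?_
    rw [Complex.re_mul_ofReal]
    exact mul_pos hz (hs.trans ht)
  rw [h1, integral_integral_swap (integrable_schlafli_prod μ hz hs), ← integral_const_mul]
  refine setIntegral_congr_fun measurableSet_Ioi fun v hv => ?_
  have hv0 : (0 : ℝ) < v := zero_lt_one.trans hv
  have hvc : (v : ℂ) ≠ 0 := by exact_mod_cast hv0.ne'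
  have hz0 : z ≠ 0 := by rintro rfl; simp at hz
  have hq : (v : ℂ) ^ 2 + 1 ≠ 0 := by exact_mod_cast (by positivity : v ^ 2 + 1 ≠ 0)
  have hre : (-(z / 2 * ((v : ℂ) + 1 / v))).re < 0 := by
    rw [show -(z / 2 * ((v : ℂ) + 1 / v)) = -(z * (((v + 1 / v) / 2 : ℝ) : ℂ)) by
      push_cast; ring, Complex.neg_re, Complex.re_mul_ofReal, neg_lt_zero]
    positivity
  have h2 : ∀ t : ℝ, schlafliWeight μ v * Complex.exp (-(z * t / 2 * (v + 1 / v)))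
      = schlafliWeight μ v * Complex.exp (-(z / 2 * ((v : ℂ) + 1 / v)) * t) := by
    intro t
    congr 2
    ring
  simp only [h2]
  rw [integral_const_mul, integral_exp_mul_complex_Ioi hre, schlafliWeight,
    show -(z / 2 * ((v : ℂ) + 1 / v)) * s = -(z * s / 2 * (v + 1 / v)) by ring,
    Complex.cpow_sub _ _ hvc, Complex.cpow_sub _ _ hvc, Complex.cpow_one]
  have h3 : (v : ℂ) + 1 / v = (v ^ 2 + 1) / v := by field_simp
  rw [neg_div_neg_eq, h3]
  field_simp

/-- The constant `∫_0^∞ v^(ν-1) / (v^2 + 1) dv`, folded onto `(1, ∞)`. -/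
noncomputable def limitConstant (ν : ℂ) : ℂ :=
  ∫ v in Ioi (1 : ℝ), ((v : ℂ) ^ (1 - ν) + (v : ℂ) ^ (ν - 1)) / (v ^ 2 + 1)

lemma norm_limitConstant_integrand_le {ν : ℂ} (hν1 : ν.re < 1) {v : ℝ} (hv : 1 < v) :
    ‖((v : ℂ) ^ (1 - ν) + (v : ℂ) ^ (ν - 1)) / (v ^ 2 + 1)‖ ≤ 2 * v ^ (-1 - ν.re) := by
  have hv0 : (0 : ℝ) < v := zero_lt_one.trans hv
  have h1 : ‖(v : ℂ) ^ 2 + 1‖ = v ^ 2 + 1 := by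
    rw [show (v : ℂ) ^ 2 + 1 = ((v ^ 2 + 1 : ℝ) : ℂ) by push_cast; rfl, Complex.norm_real,
      Real.norm_of_nonneg (by positivity)]
  have h2 : ‖(v : ℂ) ^ (1 - ν) + (v : ℂ) ^ (ν - 1)‖ ≤ 2 * v ^ (1 - ν.re) := by
    refine (norm_add_le _ _).trans ?_
    rw [Complex.norm_cpow_eq_rpow_re_of_pos hv0, Complex.norm_cpow_eq_rpow_re_of_pos hv0]
    have : v ^ (ν - 1).re ≤ v ^ (1 - ν.re) :=
      Real.rpow_le_rpow_of_exponent_le hv.le (by simp; linarith)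
    simp only [Complex.sub_re, Complex.one_re] at this ⊢
    linarith
  rw [norm_div, h1, div_le_iff₀ (by positivity)]
  refine h2.trans ?_
  have h3 : v ^ (1 - ν.re) = v ^ (-1 - ν.re) * v ^ 2 := by
    rw [← Real.rpow_add_natCast hv0.ne']
    congr 1
    push_cast
    ring
  rw [h3]
  have : 0 < v ^ (-1 - ν.re) := by positivity
  nlinarith

lemma integrableOn_limitConstant {ν : ℂ} (hν0 : 0 < ν.re) (hν1 : ν.re < 1) :
    IntegrableOn (fun v : ℝ => ((v : ℂ) ^ (1 - ν) + (v : ℂ) ^ (ν - 1)) / (v ^ 2 + 1)) (Ioi 1) := by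
  refine Integrable.mono'
    ((integrableOn_Ioi_rpow_of_lt (by linarith : -1 - ν.re < -1) one_pos).const_mul 2)
    (by fun_prop : Measurable fun v : ℝ =>
      ((v : ℂ) ^ (1 - ν) + (v : ℂ) ^ (ν - 1)) / (v ^ 2 + 1)).aestronglyMeasurable
    ((ae_restrict_iff' measurableSet_Ioi).2 (ae_of_all _ fun v hv =>
      norm_limitConstant_integrand_le hν1 hv))

/-- As `s → 0`, the integral of `K_{1+ν}` over the ray beyond `z s` is `2 K_ν(z s)` minus a
constant, up to a vanishing error. -/
lemma tendsto_mul_integral_besselK_sub {ν z : ℂ} (hν : ν.im ≠ 0) (hν0 : 0 < ν.re)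
    (hν1 : ν.re < 1) (hz : 0 < z.re) :
    Tendsto (fun s : ℝ => z * (∫ t in Ioi s, besselK (1 + ν) (z * t)) - 2 * besselK ν (z * s))
      (𝓝[>] 0) (𝓝 (-limitConstant ν)) := by
  have hpos : ∀ {s : ℝ}, 0 < s → 0 < (z * s).re := fun hs => by
    rw [Complex.re_mul_ofReal]; exact mul_pos hz hs
  have hnorm : ∀ {s v : ℝ}, 0 < s → 1 < v →
      ‖Complex.exp (-(z * s / 2 * (v + 1 / v)))‖ ≤ 1 := by
    intro s v hs hv
    have hv0 : (0 : ℝ) < v := zero_lt_one.trans hv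
    rw [Complex.norm_exp, Real.exp_le_one_iff,
      show -(z * s / 2 * ((v : ℂ) + 1 / v)) = -(z * ((s * (v + 1 / v) / 2 : ℝ) : ℂ)) by
        push_cast; ring, Complex.neg_re, Complex.re_mul_ofReal, neg_nonpos]
    positivity
  have hmeas : ∀ s : ℝ, Measurable fun v : ℝ => ((v : ℂ) ^ (1 - ν) + (v : ℂ) ^ (ν - 1)) /
      (v ^ 2 + 1) * Complex.exp (-(z * s / 2 * (v + 1 / v))) := fun s => by fun_prop
  have hlim : Tendsto (fun s : ℝ => ∫ v in Ioi (1 : ℝ),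
      ((v : ℂ) ^ (1 - ν) + (v : ℂ) ^ (ν - 1)) / (v ^ 2 + 1) *
        Complex.exp (-(z * s / 2 * (v + 1 / v)))) (𝓝[>] 0) (𝓝 (limitConstant ν)) := by
    refine tendsto_integral_filter_of_dominated_convergence
      (fun v => ‖((v : ℂ) ^ (1 - ν) + (v : ℂ) ^ (ν - 1)) / (v ^ 2 + 1)‖)
      (Eventually.of_forall fun s => (hmeas s).aestronglyMeasurable) ?_
      (integrableOn_limitConstant hν0 hν1).norm (ae_of_all _ fun v => ?_)
    · filter_upwards [self_mem_nhdsWithin] with s hs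
      refine (ae_restrict_iff' measurableSet_Ioi).2 (ae_of_all _ fun v hv => ?_)
      rw [norm_mul]
      exact mul_le_of_le_one_right (norm_nonneg _) (hnorm hs hv)
    · have hc : Continuous fun s : ℝ => ((v : ℂ) ^ (1 - ν) + (v : ℂ) ^ (ν - 1)) / (v ^ 2 + 1) *
          Complex.exp (-(z * s / 2 * (v + 1 / v))) := by fun_prop
      exact (hc.tendsto' 0 _ (by simp)).mono_left nhdsWithin_le_nhds
  refine hlim.neg.congr' ?_
  filter_upwards [self_mem_nhdsWithin] with s hs
  have hs0 : (0 : ℝ) < s := hs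
  have hint := Integrable.mono (integrableOn_limitConstant hν0 hν1) (f := fun v : ℝ =>
    ((v : ℂ) ^ (1 - ν) + (v : ℂ) ^ (ν - 1)) / (v ^ 2 + 1) *
      Complex.exp (-(z * s / 2 * (v + 1 / v)))) (hmeas s).aestronglyMeasurable
    ((ae_restrict_iff' measurableSet_Ioi).2 (ae_of_all _ fun v hv => by
      rw [norm_mul]
      exact mul_le_of_le_one_right (norm_nonneg _) (hnorm hs hv)))
  have hint2 := (integrableOn_schlafliWeight_mul_exp ν (a := z * s / 2)
    (by simpa using hpos hs0)).const_mul 2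
  rw [mul_integral_besselK (by simpa using hν) hz hs0, besselK_eq_integral hν (hpos hs0),
    ← integral_const_mul, eq_sub_iff_add_eq, neg_add_eq_sub, ← integral_sub hint2 hint]
  refine setIntegral_congr_fun measurableSet_Ioi fun v hv => ?_
  have hv0 : (0 : ℝ) < v := zero_lt_one.trans hv
  have hvc : (v : ℂ) ≠ 0 := by exact_mod_cast hv0.ne'
  have hq : (v : ℂ) ^ 2 + 1 ≠ 0 := by exact_mod_cast (by positivity : v ^ 2 + 1 ≠ 0)
  have hvν : (v : ℂ) ^ ν ≠ 0 := by simp [Complex.cpow_eq_zero_iff, hvc]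
  simp only [schlafliWeight]
  rw [neg_add, show -(1 : ℂ) + -ν = -ν - 1 by ring]
  simp only [Complex.cpow_sub _ _ hvc, Complex.cpow_add _ _ hvc, Complex.cpow_one,
    Complex.cpow_neg]
  field_simp
  ring

/-- `limitConstant ν = 1/ν + O(ν)`. -/
lemma norm_mul_limitConstant_sub_one_le {ν : ℂ} (hν0 : 0 < ν.re) (hν : ‖ν‖ ≤ 1 / 2) :
    ‖ν * limitConstant ν - 1‖ ≤ 4 * ‖ν‖ ^ 2 := by
  have hre : ν.re < 1 := by linarith [Complex.re_le_norm ν]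
  have hne : ν ≠ 0 := by rintro rfl; simp at hν0
  have hlt : (-ν - 1).re < -1 := by simp; linarith
  have h1 : ∫ v in Ioi (1 : ℝ), (v : ℂ) ^ (-ν - 1) = 1 / ν := by
    rw [integral_Ioi_cpow_of_lt hlt one_pos]
    simp
  have hdiff : limitConstant ν - 1 / ν = ∫ v in Ioi (1 : ℝ),
      ((v : ℂ) ^ (ν - 1) - (v : ℂ) ^ (-ν - 1)) / (v ^ 2 + 1) := by
    rw [← h1, limitConstant, ← integral_sub (integrableOn_limitConstant hν0 hre)
      (integrableOn_Ioi_cpow_of_lt hlt one_pos)]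
    refine setIntegral_congr_fun measurableSet_Ioi fun v hv => ?_
    have hv0 : (0 : ℝ) < v := zero_lt_one.trans hv
    have hvc : (v : ℂ) ≠ 0 := by exact_mod_cast hv0.ne'
    have hq : (v : ℂ) ^ 2 + 1 ≠ 0 := by exact_mod_cast (by positivity : v ^ 2 + 1 ≠ 0)
    have hvν : (v : ℂ) ^ ν ≠ 0 := by simp [Complex.cpow_eq_zero_iff, hvc]
    simp only [Complex.cpow_sub _ _ hvc, Complex.cpow_one, Complex.cpow_neg]
    field_simp
    ring
  have hbound : ‖∫ v in Ioi (1 : ℝ), ((v : ℂ) ^ (ν - 1) - (v : ℂ) ^ (-ν - 1)) / (v ^ 2 + 1)‖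
      ≤ ∫ v in Ioi (1 : ℝ), 2 * ‖ν‖ * v ^ (-(3 / 2) : ℝ) := by
    refine norm_integral_le_of_norm_le
      ((integrableOn_Ioi_rpow_of_lt (by norm_num : (-(3 / 2) : ℝ) < -1) one_pos).const_mul _)
      ((ae_restrict_iff' measurableSet_Ioi).2 (ae_of_all _ fun v hv => ?_))
    have hv1 : (1 : ℝ) < v := hv
    have hv0 : (0 : ℝ) < v := zero_lt_one.trans hv
    have hvc : (v : ℂ) ≠ 0 := by exact_mod_cast hv0.ne'
    have hlog : 0 ≤ Real.log v := Real.log_nonneg hv1.le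
    have hq : ‖(v : ℂ) ^ 2 + 1‖ = v ^ 2 + 1 := by
      rw [show (v : ℂ) ^ 2 + 1 = ((v ^ 2 + 1 : ℝ) : ℂ) by push_cast; rfl, Complex.norm_real,
        Real.norm_of_nonneg (by positivity)]
    have hexp : ∀ x : ℂ, ‖x‖ = ‖ν‖ →
        ‖(v : ℂ) ^ x - 1‖ ≤ ‖ν‖ * Real.log v * v ^ (1 / 2 : ℝ) := by
      intro x hx
      have h := Complex.norm_exp_sub_sum_le_norm_mul_exp (Complex.log v * x) 1
      rw [Finset.sum_range_one, pow_zero, Nat.factorial_zero, Nat.cast_one, div_one, pow_one,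
        norm_mul, ← Complex.ofReal_log hv0.le, Complex.norm_real, Real.norm_of_nonneg hlog, hx,
        mul_comm (Real.log v)] at h
      rw [Complex.cpow_def_of_ne_zero hvc, ← Complex.ofReal_log hv0.le]
      refine h.trans ?_
      rw [Real.rpow_def_of_pos hv0, mul_comm (Real.log v) (1 / 2)]
      gcongr
    have hsplit : (v : ℂ) ^ (ν - 1) - (v : ℂ) ^ (-ν - 1)
        = (((v : ℂ) ^ ν - 1) - ((v : ℂ) ^ (-ν) - 1)) / v := by
      rw [Complex.cpow_sub _ _ hvc, Complex.cpow_sub _ _ hvc, Complex.cpow_one]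
      ring
    rw [hsplit, norm_div, norm_div, hq, Complex.norm_real, Real.norm_of_nonneg hv0.le, div_div]
    rw [div_le_iff₀ (by positivity)]
    have h2 := (norm_sub_le ((v : ℂ) ^ ν - 1) ((v : ℂ) ^ (-ν) - 1)).trans
      (add_le_add (hexp ν rfl) (hexp (-ν) (norm_neg ν)))
    refine h2.trans ?_
    have hpow : v ^ (-(3 / 2) : ℝ) * v ^ 2 = v ^ (1 / 2 : ℝ) := by
      rw [← Real.rpow_add_natCast hv0.ne']
      norm_num
    have hl : Real.log v ≤ v := (Real.log_le_sub_one_of_pos hv0).trans (by linarith)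
    have hn := norm_nonneg ν
    have hw : 0 ≤ v ^ (-(3 / 2) : ℝ) := by positivity
    calc ‖ν‖ * Real.log v * v ^ (1 / 2 : ℝ) + ‖ν‖ * Real.log v * v ^ (1 / 2 : ℝ)
        = 2 * ‖ν‖ * v ^ (-(3 / 2) : ℝ) * (Real.log v * v ^ 2) := by rw [← hpow]; ring
      _ ≤ 2 * ‖ν‖ * v ^ (-(3 / 2) : ℝ) * (v * (v ^ 2 + 1)) := by
        gcongr
        linarith
  have hval : ∫ v in Ioi (1 : ℝ), 2 * ‖ν‖ * v ^ (-(3 / 2) : ℝ) = 4 * ‖ν‖ := by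
    rw [integral_const_mul, integral_Ioi_rpow_of_lt (by norm_num) one_pos]
    norm_num
    ring
  have hfac : ν * limitConstant ν - 1 = ν * (limitConstant ν - 1 / ν) := by
    field_simp
  rw [hfac, norm_mul, hdiff]
  rw [hval] at hbound
  nlinarith [norm_nonneg ν]

/-! ### Behaviour near the origin -/

lemma cpow_mul_ofReal_of_pos {t : ℝ} (ht : 0 < t) {x : ℂ} (hx : x ≠ 0) (y : ℂ) :
    (x * t) ^ y = x ^ y * (t : ℂ) ^ y := by
  have htc : (t : ℂ) ≠ 0 := by exact_mod_cast ht.ne'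
  rw [Complex.cpow_def_of_ne_zero (mul_ne_zero hx htc), Complex.cpow_def_of_ne_zero hx,
    Complex.cpow_def_of_ne_zero htc, ← Complex.exp_add, Complex.log_mul_ofReal _ ht _ hx,
    Complex.ofReal_log ht.le]
  congr 1
  ring

/-- Splitting the ray at `1`: on `(s, 1)` the integrand is its singular part plus a bounded
remainder, and letting `s → 0` cancels the divergent powers of `s`. -/
lemma norm_mul_integral_besselK_sub_le {ν z : ℂ} {B : ℝ} (hν : ν.im ≠ 0) (hν0 : 0 < ν.re)
    (hν1 : ν.re < 1) (hz : 0 < z.re)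
    (hR : ∀ t : ℝ, 0 < t → t ≤ 1 → ‖besselK (1 + ν) (z * t)
      - 1 / 2 * Complex.Gamma (1 + ν) * (z * t / 2) ^ (-(1 + ν))‖ ≤ B)
    (hK : Tendsto (fun s : ℝ => 2 * besselK ν (z * s) - Complex.Gamma ν * (z * s / 2) ^ (-ν))
      (𝓝[>] 0) (𝓝 0)) :
    ‖z * (∫ t in Ioi (1 : ℝ), besselK (1 + ν) (z * t))
      - (Complex.Gamma ν * (z / 2) ^ (-ν) - limitConstant ν)‖ ≤ ‖z‖ * B := by
  have hz0 : z ≠ 0 := by rintro rfl; simp at hz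
  have hz2 : z / 2 ≠ 0 := div_ne_zero hz0 two_ne_zero
  have hνne : ν ≠ 0 := by rintro rfl; simp at hν
  have hμ : (1 + ν).im ≠ 0 := by simpa using hν
  have hlim := (tendsto_mul_integral_besselK_sub hν hν0 hν1 hz).add hK
  rw [add_zero] at hlim
  have hlim2 := ((hlim.const_add (Complex.Gamma ν * (z / 2) ^ (-ν))).const_sub
    (z * (∫ t in Ioi (1 : ℝ), besselK (1 + ν) (z * t)))).norm
  rw [← sub_eq_add_neg] at hlim2
  refine le_of_tendsto hlim2 ?_
  have hmem : Ioo (0 : ℝ) 1 ∈ 𝓝[>] (0 : ℝ) := Ioo_mem_nhdsGT one_pos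
  filter_upwards [hmem] with s hs
  have hs0 : (0 : ℝ) < s := hs.1
  have hs1 : s ≤ 1 := hs.2.le
  have hsplit : ∫ t in Ioi s, besselK (1 + ν) (z * t)
      = (∫ t in Ioc s 1, besselK (1 + ν) (z * t))
        + ∫ t in Ioi (1 : ℝ), besselK (1 + ν) (z * t) := by
    rw [← setIntegral_union (Ioc_disjoint_Ioi le_rfl) measurableSet_Ioi
      ((integrableOn_besselK hμ hz hs0).mono_set Ioc_subset_Ioi_self)
      ((integrableOn_besselK hμ hz hs0).mono_set (Ioi_subset_Ioi hs1)), Ioc_union_Ioi_eq_Ioi hs1]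
  have hmain : ∀ t ∈ Ioc s 1, 1 / 2 * Complex.Gamma (1 + ν) * (z * t / 2) ^ (-(1 + ν))
      = 1 / 2 * Complex.Gamma (1 + ν) * (z / 2) ^ (-(1 + ν)) * (t : ℂ) ^ (-(1 + ν)) := by
    intro t ht
    rw [mul_div_right_comm, cpow_mul_ofReal_of_pos (hs0.trans ht.1) hz2]
    ring
  have h0 : (0 : ℝ) ∉ uIcc s 1 := by
    rw [uIcc_of_le hs1]
    exact fun h => absurd h.1 (not_le.2 hs0)
  have hpowint : IntegrableOn (fun t : ℝ => (t : ℂ) ^ (-(1 + ν))) (Ioc s 1) :=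
    (intervalIntegrable_iff_integrableOn_Ioc_of_le hs1).1
      (intervalIntegral.intervalIntegrable_cpow (Or.inr h0))
  have hpow : ∫ t in Ioc s 1, (t : ℂ) ^ (-(1 + ν)) = ((s : ℂ) ^ (-ν) - 1) / ν := by
    rw [← intervalIntegral.integral_of_le hs1, integral_cpow (Or.inr ⟨by simpa using hνne, h0⟩),
      show -(1 + ν) + 1 = -ν by ring, Complex.ofReal_one, Complex.one_cpow, div_neg, ← neg_div,
      neg_sub]
  have hsing : ∫ t in Ioc s 1, 1 / 2 * Complex.Gamma (1 + ν) * (z * t / 2) ^ (-(1 + ν))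
      = 1 / 2 * Complex.Gamma (1 + ν) * (z / 2) ^ (-(1 + ν)) * (((s : ℂ) ^ (-ν) - 1) / ν) := by
    rw [setIntegral_congr_fun measurableSet_Ioc hmain, integral_const_mul, hpow]
  have hsingint : IntegrableOn (fun t : ℝ => 1 / 2 * Complex.Gamma (1 + ν) *
      (z * t / 2) ^ (-(1 + ν))) (Ioc s 1) :=
    IntegrableOn.congr_fun (hpowint.const_mul _) (fun t ht => (hmain t ht).symm) measurableSet_Ioc
  have hKint := (integrableOn_besselK hμ hz hs0).mono_set (Ioc_subset_Ioi_self : Ioc s 1 ⊆ Ioi s)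
  have hrem := integral_sub hKint hsingint
  rw [hsing] at hrem
  have hG : Complex.Gamma (1 + ν) = ν * Complex.Gamma ν := by
    rw [add_comm, Complex.Gamma_add_one ν hνne]
  have hzpow : (z / 2) ^ (-(1 + ν)) = (z / 2) ^ (-ν) / (z / 2) := by
    rw [show -(1 + ν) = -ν - 1 by ring, Complex.cpow_sub _ _ hz2, Complex.cpow_one]
  have hspow : (z * s / 2) ^ (-ν) = (z / 2) ^ (-ν) * (s : ℂ) ^ (-ν) := by
    rw [mul_div_right_comm, cpow_mul_ofReal_of_pos hs0 hz2]
  have hexact : z * (∫ t in Ioi (1 : ℝ), besselK (1 + ν) (z * t))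
      - (Complex.Gamma ν * (z / 2) ^ (-ν)
        + (z * (∫ t in Ioi s, besselK (1 + ν) (z * t)) - 2 * besselK ν (z * s)
          + (2 * besselK ν (z * s) - Complex.Gamma ν * (z * s / 2) ^ (-ν))))
      = -(z * ∫ t in Ioc s 1, (besselK (1 + ν) (z * t)
          - 1 / 2 * Complex.Gamma (1 + ν) * (z * t / 2) ^ (-(1 + ν)))) := by
    rw [hrem, hsplit, hspow, hzpow, hG]
    field_simp
    ring
  rw [hexact, norm_neg, norm_mul]
  refine mul_le_mul_of_nonneg_left ?_ (norm_nonneg _)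
  have hb : ‖∫ t in Ioc s 1, (besselK (1 + ν) (z * t)
      - 1 / 2 * Complex.Gamma (1 + ν) * (z * t / 2) ^ (-(1 + ν)))‖ ≤ B * volume.real (Ioc s 1) :=
    norm_setIntegral_le_of_norm_le_const (by simp)
      (fun t ht => hR t (hs0.trans ht.1) ht.2)
  have hB : 0 ≤ B := (norm_nonneg _).trans (hR 1 one_pos le_rfl)
  rw [Real.volume_real_Ioc_of_le hs1] at hb
  nlinarith

/-- By the functional equation, passing from `k = 0` to `k = 1` divides by `1 + ν`, of modulus at
least `1/2`, and the later steps divide by numbers of modulus at least `1`. -/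
lemma norm_one_div_Gamma_add_nat_le {ν : ℂ} {M : ℝ} (hν : ‖ν‖ ≤ 1 / 2)
    (hM : ‖1 / Complex.Gamma (1 + ν)‖ ≤ M) (k : ℕ) :
    ‖1 / Complex.Gamma (ν + (k + 1 : ℕ))‖ ≤ 2 * M := by
  have hM0 : 0 ≤ M := (norm_nonneg _).trans hM
  have hlow : ∀ j : ℕ, ((j : ℝ) + 1) - 1 / 2 ≤ ‖ν + (j + 1 : ℕ)‖ := by
    intro j
    have h := norm_sub_norm_le ((j + 1 : ℕ) : ℂ) (-ν)
    rw [norm_neg, Complex.norm_natCast, sub_neg_eq_add] at h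
    rw [add_comm ν]
    push_cast at h ⊢
    linarith
  have hstep : ∀ j : ℕ, ‖1 / Complex.Gamma (ν + (j + 1 + 1 : ℕ))‖
      = ‖1 / Complex.Gamma (ν + (j + 1 : ℕ))‖ / ‖ν + (j + 1 : ℕ)‖ := by
    intro j
    have hne : ν + (j + 1 : ℕ) ≠ 0 := by
      rw [← norm_pos_iff]
      have := hlow j
      have : (0 : ℝ) ≤ j := j.cast_nonneg
      linarith
    rw [show ν + ((j + 1 + 1 : ℕ) : ℂ) = ν + (j + 1 : ℕ) + 1 by push_cast; ring,
      Complex.Gamma_add_one _ hne, norm_div, norm_div, norm_mul, div_div, mul_comm]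
  have h1 : ‖1 / Complex.Gamma (ν + (0 + 1 : ℕ))‖ ≤ M := by
    simpa [add_comm] using hM
  have h2 : ∀ j : ℕ, ‖1 / Complex.Gamma (ν + (j + 1 + 1 : ℕ))‖ ≤ 2 * M := by
    intro j
    induction j with
    | zero =>
      rw [hstep 0]
      have := hlow 0
      rw [Nat.cast_zero] at this
      have h3 : (1 / 2 : ℝ) ≤ ‖ν + (0 + 1 : ℕ)‖ := le_trans (by norm_num) this
      rw [div_le_iff₀ (one_half_pos.trans_le h3)]
      refine h1.trans ?_
      calc M = 2 * M * (1 / 2) := by ring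
        _ ≤ _ := by gcongr
    | succ j ih =>
      rw [hstep (j + 1)]
      refine (div_le_self (norm_nonneg _) ?_).trans ih
      have := hlow (j + 1)
      have : (0 : ℝ) ≤ j := j.cast_nonneg
      push_cast at *
      linarith
  cases k with
  | zero => exact h1.trans (by linarith)
  | succ j => exact h2 j

lemma exists_Gamma_bounds : ∃ r : ℝ, 0 < r ∧ r ≤ 1 / 4 ∧ ∀ ν : ℂ, ‖ν‖ ≤ r →
    ‖Complex.Gamma (1 + ν)‖ ≤ 2 ∧ ‖1 / Complex.Gamma (1 + ν)‖ ≤ 2 := by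
  have hc : ContinuousAt (fun ν : ℂ => Complex.Gamma (1 + ν)) 0 := by
    have h : ContinuousAt Complex.Gamma (1 + 0) := by
      rw [add_zero]; exact Complex.hasDerivAt_Gamma_one.continuousAt
    exact h.comp (f := fun ν : ℂ => 1 + ν) (by fun_prop)
  have hc2 : ContinuousAt (fun ν : ℂ => 1 / Complex.Gamma (1 + ν)) 0 :=
    continuousAt_const.div hc (by simp)
  have e1 : ∀ᶠ ν in 𝓝 (0 : ℂ), ‖Complex.Gamma (1 + ν)‖ < 2 :=
    hc.norm.eventually_lt continuousAt_const (by simp)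
  have e2 : ∀ᶠ ν in 𝓝 (0 : ℂ), ‖1 / Complex.Gamma (1 + ν)‖ < 2 :=
    hc2.norm.eventually_lt continuousAt_const (by simp)
  obtain ⟨δ, hδ, h⟩ := Metric.eventually_nhds_iff.1 (e1.and e2)
  refine ⟨min (δ / 2) (1 / 4), by positivity, min_le_right _ _, fun ν hν => ?_⟩
  have := @h ν (by
    rw [dist_zero_right]
    exact (hν.trans (min_le_left _ _)).trans_lt (by linarith))
  exact ⟨this.1.le, this.2.le⟩

/-- The entire factor of the power series of `I_μ`, within `O(|u|^2)` of its constant term. -/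
lemma norm_besselI_series_sub_le {a u : ℂ} {M : ℝ} (hu : ‖u‖ ≤ 1)
    (hM : ∀ m : ℕ, ‖1 / Complex.Gamma (a + (m + 1 : ℕ) + 1)‖ ≤ M) :
    ‖(∑' m : ℕ, 1 / ((m.factorial : ℂ) * Complex.Gamma (a + m + 1)) * u ^ (2 * m))
      - 1 / Complex.Gamma (a + 1)‖ ≤ 3 * M * ‖u‖ ^ 2 := by
  have hM0 : 0 ≤ M := (norm_nonneg _).trans (hM 0)
  have hterm : ∀ m : ℕ, ‖1 / (((m + 1).factorial : ℂ) * Complex.Gamma (a + (m + 1 : ℕ) + 1)) *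
      u ^ (2 * (m + 1))‖ ≤ M * ‖u‖ ^ 2 * (1 ^ m / (m.factorial : ℝ)) := by
    intro m
    have h1 : ‖u‖ ^ (2 * (m + 1)) ≤ ‖u‖ ^ 2 :=
      pow_le_pow_of_le_one (norm_nonneg _) hu (by omega)
    have h2 : 1 / ((m + 1).factorial : ℝ) ≤ 1 / (m.factorial : ℝ) := by
      have := Nat.factorial_le (Nat.le_succ m)
      gcongr
    rw [← one_div_mul_one_div_rev, norm_mul, norm_mul, norm_div 1 ((m + 1).factorial : ℂ), norm_one,
      norm_pow, Complex.norm_natCast, one_pow]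
    calc ‖1 / Complex.Gamma (a + (m + 1 : ℕ) + 1)‖ * (1 / ((m + 1).factorial : ℝ)) *
          ‖u‖ ^ (2 * (m + 1))
        = ‖1 / Complex.Gamma (a + (m + 1 : ℕ) + 1)‖ * ‖u‖ ^ (2 * (m + 1)) *
          (1 / ((m + 1).factorial : ℝ)) := by ring
      _ ≤ M * ‖u‖ ^ 2 * (1 / (m.factorial : ℝ)) := by
        have := hM m
        gcongr
  have hexp : HasSum (fun m : ℕ => (1 : ℝ) ^ m / (m.factorial : ℝ)) (Real.exp 1) := by
    rw [Real.exp_eq_exp_ℝ]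
    exact NormedSpace.expSeries_div_hasSum_exp 1
  have hsum : Summable fun m : ℕ => 1 / (((m + 1).factorial : ℂ) *
      Complex.Gamma (a + (m + 1 : ℕ) + 1)) * u ^ (2 * (m + 1)) :=
    Summable.of_norm_bounded (hexp.summable.mul_left _) hterm
  have hsum' : Summable fun m : ℕ => 1 / ((m.factorial : ℂ) * Complex.Gamma (a + m + 1)) *
      u ^ (2 * m) := (summable_nat_add_iff 1).1 hsum
  rw [hsum'.tsum_eq_zero_add]
  simp only [Nat.factorial_zero, Nat.cast_one, one_mul, Nat.cast_zero, add_zero, mul_zero,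
    pow_zero, mul_one, add_sub_cancel_left]
  refine (tsum_of_norm_bounded (hexp.mul_left _) hterm).trans ?_
  have h3 : Real.exp 1 ≤ 3 := by linarith [Real.exp_one_lt_d9]
  have : 0 ≤ M * ‖u‖ ^ 2 := by positivity
  nlinarith

lemma norm_cpow_le_rpow_mul_exp {u : ℂ} (hu : u ≠ 0) {y : ℂ} (hy : |y.im| ≤ 1) :
    ‖u ^ y‖ ≤ ‖u‖ ^ y.re * Real.exp Real.pi := by
  rw [Complex.norm_cpow_of_ne_zero hu, div_eq_mul_inv, ← Real.exp_neg]
  gcongr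
  have h1 := Complex.abs_arg_le_pi u
  have h2 : |u.arg * y.im| ≤ Real.pi := by
    rw [abs_mul]
    nlinarith [abs_nonneg u.arg, abs_nonneg y.im, Real.pi_pos]
  linarith [(abs_le.1 h2).1]

/-- `K_μ` near the origin is its leading singular term, up to explicit errors. -/
lemma norm_two_mul_besselK_sub_le {μ w : ℂ} (hμ : μ.im ≠ 0) (hμ1 : |μ.im| ≤ 1) (hw0 : w ≠ 0)
    (hw : ‖w / 2‖ ≤ 1)
    (hM1 : ∀ m : ℕ, ‖1 / Complex.Gamma (-μ + (m + 1 : ℕ) + 1)‖ ≤ 4)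
    (hM2 : ∀ m : ℕ, ‖1 / Complex.Gamma (μ + m + 1)‖ ≤ 4) :
    ‖2 * besselK μ w - Complex.Gamma μ * (w / 2) ^ (-μ)‖
      ≤ ‖Real.pi / Complex.sin (μ * Real.pi)‖ * (Real.exp Real.pi *
        (12 * ‖w / 2‖ ^ (2 - μ.re) + 16 * ‖w / 2‖ ^ μ.re)) := by
  set u := w / 2 with hu
  have hu0 : u ≠ 0 := div_ne_zero hw0 two_ne_zero
  have hun : 0 < ‖u‖ := norm_pos_iff.2 hu0
  have hG : Complex.Gamma (-μ + 1) ≠ 0 := by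
    refine Complex.Gamma_ne_zero fun m h => hμ ?_
    simpa using congrArg Complex.im h
  have hrefl := Complex.Gamma_mul_Gamma_one_sub μ
  rw [show 1 - μ = -μ + 1 by ring, mul_comm (Real.pi : ℂ)] at hrefl
  have hGμ : Complex.Gamma μ
      = Real.pi / Complex.sin (μ * Real.pi) * (1 / Complex.Gamma (-μ + 1)) := by
    rw [← hrefl]
    field_simp
  have hA := norm_besselI_series_sub_le (a := -μ) hw hM1
  have hB := norm_besselI_series_sub_le (a := μ) hw (fun m => hM2 (m + 1))
  set S₁ := ∑' m : ℕ, 1 / ((m.factorial : ℂ) * Complex.Gamma (-μ + m + 1)) * u ^ (2 * m) with hS₁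
  set S₂ := ∑' m : ℕ, 1 / ((m.factorial : ℂ) * Complex.Gamma (μ + m + 1)) * u ^ (2 * m) with hS₂
  have hB' : ‖S₂‖ ≤ 16 := by
    have h0 := hM2 0
    rw [Nat.cast_zero, add_zero] at h0
    have h1 : ‖u‖ ^ 2 ≤ 1 := pow_le_one₀ (norm_nonneg _) hw
    have h2 := norm_add_le (S₂ - 1 / Complex.Gamma (μ + 1)) (1 / Complex.Gamma (μ + 1))
    rw [sub_add_cancel] at h2
    linarith
  have hid : 2 * besselK μ w - Complex.Gamma μ * u ^ (-μ)
      = Real.pi / Complex.sin (μ * Real.pi) *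
        (u ^ (-μ) * (S₁ - 1 / Complex.Gamma (-μ + 1)) - u ^ μ * S₂) := by
    rw [hGμ, besselK, besselI, besselI, ← hu, ← hS₁, ← hS₂]
    ring
  rw [hid, norm_mul]
  refine mul_le_mul_of_nonneg_left ?_ (norm_nonneg _)
  refine (norm_sub_le _ _).trans ?_
  rw [norm_mul, norm_mul]
  have h1 : ‖u ^ (-μ)‖ ≤ ‖u‖ ^ (-μ).re * Real.exp Real.pi :=
    norm_cpow_le_rpow_mul_exp hu0 (by simpa using hμ1)
  have h2 : ‖u ^ μ‖ ≤ ‖u‖ ^ μ.re * Real.exp Real.pi := norm_cpow_le_rpow_mul_exp hu0 hμ1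
  have h3 : ‖u‖ ^ (2 - μ.re) = ‖u‖ ^ (-μ).re * ‖u‖ ^ 2 := by
    rw [← Real.rpow_add_natCast hun.ne']
    congr 1
    simp
    ring
  rw [h3]
  calc ‖u ^ (-μ)‖ * ‖S₁ - 1 / Complex.Gamma (-μ + 1)‖ + ‖u ^ μ‖ * ‖S₂‖
      ≤ ‖u‖ ^ (-μ).re * Real.exp Real.pi * (3 * 4 * ‖u‖ ^ 2)
        + ‖u‖ ^ μ.re * Real.exp Real.pi * 16 := by gcongr
    _ = _ := by ring

/-- The reflection formula in the form `π / sin(πν) = Γ(1+ν) Γ(1-ν) / ν`. -/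
lemma norm_pi_div_sin_le {ν : ℂ} (hν : ν ≠ 0) (h1 : ‖Complex.Gamma (1 + ν)‖ ≤ 2)
    (h2 : ‖Complex.Gamma (1 + -ν)‖ ≤ 2) :
    ‖Real.pi / Complex.sin (ν * Real.pi)‖ ≤ 4 / ‖ν‖ := by
  have hrefl := Complex.Gamma_mul_Gamma_one_sub ν
  rw [mul_comm (Real.pi : ℂ)] at hrefl
  have hn : 0 < ‖ν‖ := norm_pos_iff.2 hν
  have hG : Complex.Gamma (1 + ν) = ν * Complex.Gamma ν := by
    rw [add_comm, Complex.Gamma_add_one ν hν]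
  rw [hG, norm_mul] at h1
  rw [← hrefl, norm_mul, sub_eq_add_neg, le_div_iff₀ hn]
  nlinarith [norm_nonneg (Complex.Gamma (1 + -ν)), norm_nonneg (Complex.Gamma ν),
    mul_nonneg hn.le (norm_nonneg (Complex.Gamma ν))]

/-- Uniform asymptotics of the ray integral of `K_{1+ν}` for small `ν` and small `z`. -/
lemma exists_norm_mul_integral_besselK_sub_le : ∃ r : ℝ, 0 < r ∧ r ≤ 1 / 4 ∧ ∃ C : ℝ, 0 < C ∧
    ∀ ν : ℂ, ‖ν‖ ≤ r → 0 < ν.re → ν.im ≠ 0 → ∀ z : ℂ, 0 < z.re → ‖z‖ ≤ 1 →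
      ‖ν * (z * ∫ t in Ioi (1 : ℝ), besselK (1 + ν) (z * t))
        - (Complex.Gamma (1 + ν) * (z / 2) ^ (-ν) - ν * limitConstant ν)‖ ≤ C * ‖z‖ := by
  obtain ⟨r, hr0, hr4, hΓ⟩ := exists_Gamma_bounds
  refine ⟨r, hr0, hr4, 56 * Real.exp Real.pi, by positivity, ?_⟩
  intro ν hνr hre him z hz hz1
  have hν : ν ≠ 0 := by rintro rfl; simp at hre
  have hn : 0 < ‖ν‖ := norm_pos_iff.2 hν
  have hσ : ν.re ≤ 1 / 4 := (Complex.re_le_norm ν).trans (hνr.trans hr4)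
  have hτ : |ν.im| ≤ 1 := (Complex.abs_im_le_norm ν).trans (by linarith)
  have hz0 : z ≠ 0 := by rintro rfl; simp at hz
  obtain ⟨hp1, hp2⟩ := hΓ ν hνr
  obtain ⟨hm1, hm2⟩ := hΓ (-ν) (by rwa [norm_neg])
  have hbp := norm_one_div_Gamma_add_nat_le (ν := ν) (by linarith) hp2
  have hbm := norm_one_div_Gamma_add_nat_le (ν := -ν) (by rw [norm_neg]; linarith) hm2
  norm_num only at hbp hbm
  have hsin := norm_pi_div_sin_le hν hp1 hm1
  have hsin' : ‖Real.pi / Complex.sin ((1 + ν) * Real.pi)‖ ≤ 4 / ‖ν‖ := by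
    rw [show (1 + ν) * (Real.pi : ℂ) = ν * Real.pi + Real.pi by ring, Complex.sin_add_pi, div_neg,
      norm_neg]
    exact hsin
  have hnorm : ∀ t : ℝ, 0 < t → t ≤ 1 → ‖z * t / 2‖ ≤ 1 ∧ z * t ≠ 0 := by
    intro t ht ht1
    refine ⟨?_, mul_ne_zero hz0 (by exact_mod_cast ht.ne')⟩
    rw [norm_div, norm_mul, Complex.norm_real, Real.norm_of_nonneg ht.le, Complex.norm_ofNat]
    nlinarith [norm_nonneg z]
  have hR : ∀ t : ℝ, 0 < t → t ≤ 1 → ‖besselK (1 + ν) (z * t)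
      - 1 / 2 * Complex.Gamma (1 + ν) * (z * t / 2) ^ (-(1 + ν))‖
        ≤ 56 * Real.exp Real.pi / ‖ν‖ := by
    intro t ht ht1
    obtain ⟨hw, hw0⟩ := hnorm t ht ht1
    have h := norm_two_mul_besselK_sub_le (μ := 1 + ν) (by simpa using him) (by simpa using hτ) hw0
      hw (fun m => by
        rw [show -(1 + ν) + ((m + 1 : ℕ) : ℂ) + 1 = -ν + (m + 1 : ℕ) by ring]
        exact hbm m) (fun m => by
        rw [show 1 + ν + (m : ℂ) + 1 = ν + (m + 1 + 1 : ℕ) by push_cast; ring]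
        exact hbp (m + 1))
    have e1 : ‖z * t / 2‖ ^ (2 - (1 + ν).re) ≤ 1 :=
      Real.rpow_le_one (norm_nonneg _) hw (by simp; linarith)
    have e2 : ‖z * t / 2‖ ^ (1 + ν).re ≤ 1 :=
      Real.rpow_le_one (norm_nonneg _) hw (by simp; linarith)
    have e3 : 2 * besselK (1 + ν) (z * t) - Complex.Gamma (1 + ν) * (z * t / 2) ^ (-(1 + ν))
        = 2 * (besselK (1 + ν) (z * t)
          - 1 / 2 * Complex.Gamma (1 + ν) * (z * t / 2) ^ (-(1 + ν))) := by ring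
    rw [e3, norm_mul, Complex.norm_ofNat] at h
    have h4 : ‖Real.pi / Complex.sin ((1 + ν) * Real.pi)‖ * (Real.exp Real.pi *
        (12 * ‖z * t / 2‖ ^ (2 - (1 + ν).re) + 16 * ‖z * t / 2‖ ^ (1 + ν).re))
        ≤ 4 / ‖ν‖ * (Real.exp Real.pi * (12 * 1 + 16 * 1)) := by gcongr
    have h5 : 4 / ‖ν‖ * (Real.exp Real.pi * (12 * 1 + 16 * 1))
        = 2 * (56 * Real.exp Real.pi / ‖ν‖) := by ring
    linarith
  have hK : Tendsto (fun s : ℝ => 2 * besselK ν (z * s) - Complex.Gamma ν * (z * s / 2) ^ (-ν))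
      (𝓝[>] 0) (𝓝 0) := by
    have hcont : Tendsto (fun s : ℝ => 4 / ‖ν‖ * (Real.exp Real.pi *
        (12 * ‖z * s / 2‖ ^ (2 - ν.re) + 16 * ‖z * s / 2‖ ^ ν.re))) (𝓝[>] 0) (𝓝 0) := by
      have hb : Tendsto (fun s : ℝ => ‖z * s / 2‖) (𝓝 0) (𝓝 0) := by
        have : Continuous fun s : ℝ => ‖z * s / 2‖ := by fun_prop
        exact this.tendsto' 0 0 (by simp)
      have hb1 := hb.rpow_const (p := 2 - ν.re) (Or.inr (by linarith))
      have hb2 := hb.rpow_const (p := ν.re) (Or.inr hre.le)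
      rw [Real.zero_rpow (by linarith)] at hb1
      rw [Real.zero_rpow (by linarith)] at hb2
      have := ((((hb1.const_mul 12).add (hb2.const_mul 16)).const_mul
        (Real.exp Real.pi)).const_mul (4 / ‖ν‖))
      simp only [mul_zero, add_zero] at this
      exact this.mono_left nhdsWithin_le_nhds
    refine squeeze_zero_norm' ?_ hcont
    filter_upwards [Ioo_mem_nhdsGT (one_pos : (0 : ℝ) < 1)] with s hs
    obtain ⟨hw, hw0⟩ := hnorm s hs.1 hs.2.le
    refine (norm_two_mul_besselK_sub_le him hτ hw0 hw (fun m => ?_) (fun m => ?_)).trans (by gcongr)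
    · rw [show -ν + ((m + 1 : ℕ) : ℂ) + 1 = -ν + (m + 1 + 1 : ℕ) by push_cast; ring]
      exact hbm (m + 1)
    · rw [show ν + (m : ℂ) + 1 = ν + (m + 1 : ℕ) by push_cast; ring]
      exact hbp m
  have h := norm_mul_integral_besselK_sub_le him hre (by linarith) hz hR hK
  have hfac : ν * (z * ∫ t in Ioi (1 : ℝ), besselK (1 + ν) (z * t))
      - (Complex.Gamma (1 + ν) * (z / 2) ^ (-ν) - ν * limitConstant ν)
      = ν * (z * (∫ t in Ioi (1 : ℝ), besselK (1 + ν) (z * t))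
        - (Complex.Gamma ν * (z / 2) ^ (-ν) - limitConstant ν)) := by
    rw [add_comm 1 ν, Complex.Gamma_add_one ν hν]
    ring
  rw [hfac, norm_mul]
  calc ‖ν‖ * _ ≤ ‖ν‖ * (‖z‖ * (56 * Real.exp Real.pi / ‖ν‖)) := by gcongr
    _ = 56 * Real.exp Real.pi * ‖z‖ := by field_simp

/-! ### Lower bounds -/

/-- Second-order expansion of `log Γ` at `1`; the linear coefficient `-γ` is real. -/
lemma exists_Gamma_one_add_eq_exp : ∃ r : ℝ, 0 < r ∧ ∃ D : ℝ, 0 < D ∧ ∀ ν : ℂ, ‖ν‖ ≤ r →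
    ∃ ρ : ℂ, ‖ρ‖ ≤ D * ‖ν‖ ^ 2 ∧
      Complex.Gamma (1 + ν) = Complex.exp (-Real.eulerMascheroniConstant * ν + ρ) := by
  set f : ℂ → ℂ := fun s => Complex.log (Complex.Gamma s)⁻¹ with hf
  have hinv : AnalyticAt ℂ (fun s : ℂ => (Complex.Gamma s)⁻¹) 1 :=
    Complex.differentiable_one_div_Gamma.analyticAt 1
  have han : AnalyticAt ℂ f 1 := hinv.clog (by simp [Complex.one_mem_slitPlane])
  have hder : deriv f 1 = Real.eulerMascheroniConstant := by
    have h1 := Complex.hasDerivAt_Gamma_one.fun_inv (by simp)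
    have h2 := h1.clog (by simp [Complex.one_mem_slitPlane])
    rw [hf, h2.deriv]
    simp
  obtain ⟨p, hp⟩ := han
  have hO := hp.isBigO_sub_partialSum_pow 2
  obtain ⟨D, hD0, hD⟩ := hO.exists_pos
  rw [Asymptotics.IsBigOWith] at hD
  have hne : ∀ᶠ y in 𝓝 (0 : ℂ), Complex.Gamma (1 + y) ≠ 0 := by
    have hc : ContinuousAt (fun ν : ℂ => Complex.Gamma (1 + ν)) 0 := by
      have h : ContinuousAt Complex.Gamma (1 + 0) := by
        rw [add_zero]; exact Complex.hasDerivAt_Gamma_one.continuousAt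
      exact h.comp (f := fun ν : ℂ => 1 + ν) (by fun_prop)
    exact hc.eventually_ne (by simp)
  obtain ⟨δ, hδ, h⟩ := Metric.eventually_nhds_iff.1 (hD.and hne)
  refine ⟨δ / 2, by positivity, D, hD0, fun ν hν => ?_⟩
  obtain ⟨h1, h2⟩ := @h ν (by rw [dist_zero_right]; linarith)
  have hps : p.partialSum 2 ν = Real.eulerMascheroniConstant * ν := by
    rw [FormalMultilinearSeries.partialSum, Finset.sum_range_succ, Finset.sum_range_one]
    have e0 : (p 0 fun _ => ν) = 0 := by
      rw [hp.coeff_zero]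
      simp [hf]
    have e1 : (p 1 fun _ => ν) = Real.eulerMascheroniConstant * ν := by
      rw [← hder, hp.deriv, show (fun _ : Fin 1 => ν) = fun _ => ν • (1 : ℂ) by simp,
        (p 1).map_smul_univ (fun _ => ν) (fun _ => 1)]
      simp [mul_comm]
    rw [e0, e1, zero_add]
  rw [hps] at h1
  refine ⟨-(f (1 + ν) - Real.eulerMascheroniConstant * ν), ?_, ?_⟩
  · rw [norm_neg]
    simpa using h1
  · rw [show -(Real.eulerMascheroniConstant : ℂ) * ν
        + -(f (1 + ν) - Real.eulerMascheroniConstant * ν) = -f (1 + ν) by ring, Complex.exp_neg,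
      hf]
    simp only
    rw [Complex.exp_log (inv_ne_zero h2), inv_inv]

/-- The ratio of the two main terms is `exp (ν (log 2 - γ - log z) + O(ν^2))`. -/
lemma exists_Gamma_mul_cpow_eq : ∃ r : ℝ, 0 < r ∧ ∃ D : ℝ, 0 < D ∧
    ∀ ν : ℂ, ‖ν‖ ≤ r → 0 < ν.re → 1 / 2 ≤ ‖ν * limitConstant ν‖ ∧ ∃ ρ : ℂ, ‖ρ‖ ≤ D * ‖ν‖ ^ 2 ∧
      ∀ z : ℂ, z ≠ 0 → Complex.Gamma (1 + ν) * (z / 2) ^ (-ν) = ν * limitConstant ν *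
        Complex.exp (ν * ((Real.log 2 - Real.eulerMascheroniConstant : ℝ) - Complex.log z)
          + ρ) := by
  obtain ⟨r, hr, D, hD, h⟩ := exists_Gamma_one_add_eq_exp
  refine ⟨min r (1 / 4), by positivity, D + 6, by positivity, fun ν hν hre => ?_⟩
  have hν4 : ‖ν‖ ≤ 1 / 4 := hν.trans (min_le_right _ _)
  have hn := norm_nonneg ν
  obtain ⟨ρ, hρ, hΓ⟩ := h ν (hν.trans (min_le_left _ _))
  have hM := norm_mul_limitConstant_sub_one_le hre (by linarith)
  set q := ν * limitConstant ν with hq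
  have hM2 : ‖q - 1‖ ≤ 1 / 2 := hM.trans (by nlinarith)
  have hq2 : 1 / 2 ≤ ‖q‖ := by
    have := norm_sub_norm_le (1 : ℂ) (1 - q)
    rw [sub_sub_cancel, norm_one, norm_sub_rev] at this
    linarith
  have hq0 : q ≠ 0 := by rw [← norm_pos_iff]; linarith
  have hlog := Complex.norm_log_one_add_half_le_self hM2
  rw [add_sub_cancel] at hlog
  refine ⟨hq2, ρ - Complex.log q, ?_, fun z hz => ?_⟩
  · refine (norm_sub_le _ _).trans ?_
    linarith
  · have hz2 : z / 2 ≠ 0 := div_ne_zero hz two_ne_zero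
    have hlz : Complex.log (z / 2) = Complex.log z - Real.log 2 := by
      have := Complex.log_mul_ofReal (1 / 2) (by norm_num) z hz
      rw [show z / 2 = z * ((1 / 2 : ℝ) : ℂ) by push_cast; ring, this, one_div, Real.log_inv]
      push_cast
      ring
    rw [hΓ, Complex.cpow_def_of_ne_zero hz2, hlz, ← Complex.exp_add]
    nth_rewrite 1 [← Complex.exp_log hq0]
    rw [← Complex.exp_add]
    congr 1
    push_cast
    ring

/-- Quantitative nonvanishing of `e^w - 1` for `w ≈ (σ + iτ)(X - iθ)`, `σ ≈ τ²/2`. Either `Re w` is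
at least a multiple of `τ² X`, or `|τ| X` is too small for `Im w` to reach `2π`. -/
lemma norm_exp_sub_one_ge {σ τ X θ D : ℝ} {w : ℂ} (hσ : 0 < σ) (hστ : σ * (2 + σ) = τ ^ 2)
    (hτ : |τ| ≤ 1 / 100) (hDτ : D * |τ| ≤ 1 / 100) (hθ : |θ| ≤ Real.pi / 2) (hX : 1 ≤ X)
    (hw : ‖w - (σ + τ * Complex.I) * (X - θ * Complex.I)‖ ≤ D * τ ^ 2) :
    1 / 18 * Real.exp w.re * min 1 (τ ^ 2 * X) ≤ ‖Complex.exp w - 1‖ := by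
  have hpi := Real.pi_gt_d2
  have hpi2 := Real.pi_lt_d2
  have hτ0 : 0 ≤ |τ| := abs_nonneg τ
  have hsq : |τ| ^ 2 = τ ^ 2 := sq_abs τ
  have hσ1 : σ ≤ τ ^ 2 / 2 := by linarith [mul_self_nonneg σ]
  have hτsq : τ ^ 2 ≤ (1 / 100) ^ 2 := by rw [← hsq]; gcongr
  have hσ2 : τ ^ 2 ≤ 2.01 * σ := by
    have h1 : σ * σ ≤ 1 / 100 * σ := by
      gcongr
      linarith
    linarith
  have herr : D * τ ^ 2 ≤ |τ| / 100 := by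
    calc D * τ ^ 2 = D * |τ| * |τ| := by rw [← hsq]; ring
      _ ≤ 1 / 100 * |τ| := by gcongr
      _ = |τ| / 100 := by ring
  have hre := (Complex.abs_re_le_norm _).trans (hw.trans herr)
  have him := (Complex.abs_im_le_norm _).trans (hw.trans herr)
  have ere : (w - (σ + τ * Complex.I) * (X - θ * Complex.I)).re = w.re - (σ * X + τ * θ) := by
    simp
  have eim : (w - (σ + τ * Complex.I) * (X - θ * Complex.I)).im = w.im - (τ * X - σ * θ) := by
    simp
    ring
  rw [ere] at hre
  rw [eim] at him
  have hθτ : |τ * θ| ≤ |τ| * (Real.pi / 2) := by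
    rw [abs_mul]; gcongr
  have hθσ : |σ * θ| ≤ |τ| / 100 := by
    rw [abs_mul, abs_of_pos hσ]
    have h1 : |τ| * |τ| ≤ |τ| * (1 / 100) := by gcongr
    have h2 : σ ≤ |τ| / 200 := by linarith
    calc σ * |θ| ≤ |τ| / 200 * 2 := by
          gcongr
          linarith
      _ = |τ| / 100 := by ring
  have hexp0 := Real.exp_pos w.re
  have hnorm : ‖Complex.exp w‖ = Real.exp w.re := Complex.norm_exp w
  rcases le_or_gt (σ * X / 4) w.re with hA | hB
  · have h1 : Real.exp w.re - 1 ≤ ‖Complex.exp w - 1‖ := by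
      have := norm_sub_norm_le (Complex.exp w) 1
      rwa [hnorm, norm_one] at this
    set y := σ * X / 4 with hy
    have hy0 : 0 < y := by positivity
    have hyt : τ ^ 2 * X / 9 ≤ y := by
      have : τ ^ 2 * X ≤ 2.01 * σ * X := by gcongr
      rw [hy]
      linarith
    -- `1 - e^{-y} ≥ min(1, y) / 2`
    have h2 : min 1 (τ ^ 2 * X) / 18 ≤ 1 - Real.exp (-w.re) := by
      have h3 : Real.exp (-w.re) ≤ Real.exp (-y) := Real.exp_le_exp.2 (by linarith)
      have h4 : Real.exp (-y) * (1 + y) ≤ 1 := by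
        have h5 := Real.add_one_le_exp y
        have h6 : Real.exp (-y) * Real.exp y = 1 := by rw [← Real.exp_add]; simp
        rw [← h6]
        gcongr
        linarith
      have h8 : Real.exp (-y) ≤ 1 / (1 + y) := by rwa [le_div_iff₀ (by linarith)]
      have h9 : min 1 (τ ^ 2 * X) / 18 ≤ 1 - 1 / (1 + y) := by
        rw [show 1 - 1 / (1 + y) = y / (1 + y) by field_simp; ring, le_div_iff₀ (by linarith)]
        have m1 := min_le_left 1 (τ ^ 2 * X)
        have m2 := min_le_right 1 (τ ^ 2 * X)
        have m3 : min 1 (τ ^ 2 * X) * y ≤ 1 * y := by gcongr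
        linarith
      linarith
    have h10 : Real.exp w.re * Real.exp (-w.re) = 1 := by rw [← Real.exp_add]; simp
    calc 1 / 18 * Real.exp w.re * min 1 (τ ^ 2 * X)
        = Real.exp w.re * (min 1 (τ ^ 2 * X) / 18) := by ring
      _ ≤ Real.exp w.re * (1 - Real.exp (-w.re)) := by gcongr
      _ = Real.exp w.re - 1 := by rw [mul_sub, h10, mul_one]
      _ ≤ _ := h1
  · -- here `|τ| X < (4/3)(2.01)(π/2 + 0.01) < 3π/2`
    have hre' := abs_le.1 hre
    have hθτ' := abs_le.1 hθτ
    have hσX : 3 / 4 * (σ * X) ≤ |τ| * (Real.pi / 2 + 1 / 100) := by linarith [hre'.1, hθτ'.1]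
    have hτpos : 0 < |τ| := by
      rw [abs_pos, ← sq_pos_iff, ← hστ]
      positivity
    have hτX : |τ| * X ≤ 4.25 := by
      have h1 : |τ| * (|τ| * X) ≤ |τ| * 4.25 := by
        have h2 : τ ^ 2 * X ≤ 2.01 * σ * X := by gcongr
        have h3 : |τ| * (Real.pi / 2 + 1 / 100) ≤ |τ| * 1.585 := by
          gcongr
          linarith
        rw [← mul_assoc, ← sq, hsq]
        linarith
      exact le_of_mul_le_mul_left h1 hτpos
    have hτXabs : |τ * X| = |τ| * X := by rw [abs_mul, abs_of_pos (by linarith : (0:ℝ) < X)]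
    have hω1 : |w.im| ≤ |τ| * X + |τ| / 50 := by
      have h1 := abs_add_three (w.im - (τ * X - σ * θ)) (τ * X) (-(σ * θ))
      rw [abs_neg, show w.im - (τ * X - σ * θ) + τ * X + -(σ * θ) = w.im by ring, hτXabs] at h1
      linarith
    have hω2 : |τ| * X - |τ| / 50 ≤ |w.im| := by
      have h1 := abs_add_three (-(w.im - (τ * X - σ * θ))) (w.im) (σ * θ)
      rw [abs_neg, show -(w.im - (τ * X - σ * θ)) + w.im + σ * θ = τ * X by ring, hτXabs] at h1
      linarith
    rcases le_or_gt (Real.pi / 2) |w.im| with hC | hC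
    · have hcos : Real.cos w.im ≤ 0 := by
        rw [← Real.cos_abs]
        exact Real.cos_nonpos_of_pi_div_two_le_of_le hC (by linarith)
      have h1 : 1 ≤ ‖Complex.exp w - 1‖ := by
        have h2 := Complex.abs_re_le_norm (Complex.exp w - 1)
        rw [Complex.sub_re, Complex.exp_re, Complex.one_re] at h2
        have h3 := neg_le_abs (Real.exp w.re * Real.cos w.im - 1)
        have h4 := mul_nonpos_of_nonneg_of_nonpos hexp0.le hcos
        linarith
      have h4 : Real.exp w.re ≤ 3 := by
        have h5 : w.re ≤ 1 := by
          have h6 : σ * X ≤ τ ^ 2 / 2 * X := by gcongr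
          have h7 : τ ^ 2 * X = |τ| * (|τ| * X) := by rw [← hsq]; ring
          have h8 : |τ| * (|τ| * X) ≤ 1 / 100 * 4.25 := by gcongr
          linarith
        have := Real.exp_le_exp.2 h5
        linarith [Real.exp_one_lt_d9]
      calc 1 / 18 * Real.exp w.re * min 1 (τ ^ 2 * X) ≤ 1 / 18 * 3 * 1 := by
            gcongr
            exact min_le_left _ _
        _ ≤ 1 := by norm_num
        _ ≤ _ := h1
    · have hsin : 2 / Real.pi * |w.im| ≤ |Real.sin w.im| := by
        have h1 := Real.mul_le_sin (abs_nonneg w.im) hC.le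
        rcases abs_choice w.im with h | h
        · rw [h] at h1 ⊢; exact h1.trans (le_abs_self _)
        · rw [h] at h1 ⊢; rw [Real.sin_neg] at h1; exact h1.trans (neg_le_abs _)
      have h2 : 1 / 2 * |w.im| ≤ |Real.sin w.im| := by
        refine le_trans ?_ hsin
        refine mul_le_mul_of_nonneg_right ?_ (abs_nonneg _)
        rw [div_le_div_iff₀ two_pos (by linarith)]
        linarith
      have h3 := Complex.abs_im_le_norm (Complex.exp w - 1)
      rw [Complex.sub_im, Complex.exp_im, Complex.one_im, sub_zero, abs_mul, abs_of_pos hexp0] at h3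
      have m2 := min_le_right 1 (τ ^ 2 * X)
      have h4 : 1 / 18 * (τ ^ 2 * X) ≤ |Real.sin w.im| := by
        have h5 : τ ^ 2 * X = |τ| * (|τ| * X) := by rw [← hsq]; ring
        have h6 : |τ| * (|τ| * X) ≤ 1 / 100 * (|τ| * X) := by gcongr
        have h7 : |τ| * 1 ≤ |τ| * X := by gcongr
        linarith
      calc 1 / 18 * Real.exp w.re * min 1 (τ ^ 2 * X)
          ≤ 1 / 18 * Real.exp w.re * (τ ^ 2 * X) := by gcongr
        _ = Real.exp w.re * (1 / 18 * (τ ^ 2 * X)) := by ring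
        _ ≤ Real.exp w.re * |Real.sin w.im| := by gcongr
        _ ≤ _ := h3

/-- `ν = μ_n - 1` satisfies `2ν + ν² = i n β`; its real part is of order `β²`, its imaginary part of
order `β`. -/
lemma besselOrder_sub_one_bounds {n : ℤ} (hn : |n| = 1) {β : ℝ} (hβ : 0 < β) (hβ1 : β ≤ 1) :
    ∃ ν : ℂ, besselOrder n β = 1 + ν ∧ 0 < ν.re ∧ ν.re * (2 + ν.re) = ν.im ^ 2 ∧
      β / 4 ≤ |ν.im| ∧ |ν.im| ≤ β / 2 ∧ ‖ν‖ ≤ β := by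
  have hn2 : (n : ℝ) ^ 2 = 1 := by
    have : n ^ 2 = 1 := by rw [← sq_abs, hn, one_pow]
    exact_mod_cast this
  have hnabs : |(n : ℝ)| = 1 := by exact_mod_cast hn
  have hsq : besselOrder n β ^ 2 = (n : ℂ) ^ 2 + Complex.I * n * β := by
    rw [besselOrder, Complex.sqrt, show (2⁻¹ : ℂ) = ((2 : ℕ) : ℂ)⁻¹ by norm_num,
      Complex.cpow_nat_inv_pow _ two_ne_zero]
  have hre0 : 0 ≤ (besselOrder n β).re := by
    rw [besselOrder, Complex.sqrt, Complex.cpow_inv_two_re]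
    positivity
  generalize besselOrder n β = μ at hsq hre0
  have h1 := congrArg Complex.re hsq
  have h2 := congrArg Complex.im hsq
  have hncre : ((n : ℂ) ^ 2).re = 1 := by
    rw [show (n : ℂ) ^ 2 = (((n : ℝ) ^ 2 : ℝ) : ℂ) by push_cast; rfl, Complex.ofReal_re, hn2]
  have hncim : ((n : ℂ) ^ 2).im = 0 := by
    rw [show (n : ℂ) ^ 2 = (((n : ℝ) ^ 2 : ℝ) : ℂ) by push_cast; rfl, Complex.ofReal_im]
  have h3 : μ.re ^ 2 - μ.im ^ 2 = 1 := by
    rw [Complex.add_re, hncre, sq μ, Complex.mul_re] at h1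
    simp at h1
    linarith
  have h4 : 2 * μ.re * μ.im = n * β := by
    rw [Complex.add_im, hncim, sq μ, Complex.mul_im] at h2
    simp at h2
    linarith
  set σ := μ.re - 1 with hσ
  have hre : μ.re = 1 + σ := by rw [hσ]; ring
  rw [hre] at h3 h4 hre0
  have him0 : μ.im ≠ 0 := by
    intro h
    rw [h, mul_zero] at h4
    have := congrArg abs h4
    rw [abs_mul, hnabs, abs_zero, abs_of_pos hβ] at this
    linarith
  have him2 : 0 < μ.im ^ 2 := by positivity
  have hσ0 : 0 < σ := by nlinarith
  have habs : 2 * (1 + σ) * |μ.im| = β := by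
    have := congrArg abs h4
    rw [abs_mul, abs_mul, abs_mul (n : ℝ), hnabs, abs_of_pos hβ,
      abs_of_pos (by linarith : (0 : ℝ) < 1 + σ), abs_two, one_mul] at this
    exact this
  have hsqabs : |μ.im| ^ 2 = μ.im ^ 2 := sq_abs _
  have ht0 := abs_nonneg μ.im
  have hup : |μ.im| ≤ β / 2 := by nlinarith
  have hσ1 : σ ≤ β / 2 := by nlinarith
  have eq1 : (μ - 1).re = σ := by simp [hσ]
  have eq2 : (μ - 1).im = μ.im := by simp
  refine ⟨μ - 1, by ring, ?_, ?_, ?_, ?_, ?_⟩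
  · rw [eq1]; exact hσ0
  · rw [eq1, eq2]; linarith
  · rw [eq2]; nlinarith
  · rw [eq2]; exact hup
  · refine (Complex.norm_le_abs_re_add_abs_im _).trans ?_
    rw [eq1, eq2, abs_of_pos hσ0]
    linarith

lemma besselF_eq {n : ℤ} (hn : |n| = 1) (z : ℂ) (β : ℝ) :
    besselF n z β = ∫ s in Ioi (1 : ℝ), besselK (besselOrder n β) (z * s) := by
  simp [besselF, hn]

lemma log_complex_sqrt {lam : ℂ} (h : lam ≠ 0) :
    Complex.log (Complex.sqrt lam) = Complex.log lam / 2 := by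
  rw [Complex.sqrt, Complex.cpow_def_of_ne_zero h, Complex.log_exp, div_eq_mul_inv]
  · have := Complex.neg_pi_lt_log_im lam
    rw [← div_eq_mul_inv, Complex.div_ofNat_im]
    linarith [Real.pi_pos]
  · have := Complex.log_im_le_pi lam
    rw [← div_eq_mul_inv, Complex.div_ofNat_im]
    linarith [Real.pi_pos]

lemma complex_sqrt_re_pos {lam : ℂ} (h : lam ∈ Complex.slitPlane) : 0 < (Complex.sqrt lam).re := by
  obtain ⟨h1, h2⟩ := Complex.mem_slitPlane_iff_arg.1 h
  rw [Complex.sqrt, Complex.cpow_def_of_ne_zero h2, ← div_eq_mul_inv, Complex.exp_re]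
  refine mul_pos (Real.exp_pos _) (Real.cos_pos_of_mem_Ioo ⟨?_, ?_⟩)
  · rw [Complex.div_ofNat_im, Complex.log_im]
    linarith [Complex.neg_pi_lt_arg lam]
  · rw [Complex.div_ofNat_im, Complex.log_im]
    linarith [lt_of_le_of_ne (Complex.arg_le_pi lam) h1]

/-- The lower bound, uniformly on the slit plane. -/
lemma exists_besselF_lower_bound : ∃ β₀ : ℝ, 0 < β₀ ∧ ∃ c : ℝ, 0 < c ∧
    ∀ n : ℤ, |n| = 1 → ∀ β ∈ Ioo (0 : ℝ) β₀, ∀ lam ∈ Complex.slitPlane, ‖lam‖ < β ^ 4 →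
      c / β * ‖lam‖ ^ (-((besselOrder n β).re / 2)) * min 1 (-(β ^ 2 * Real.log ‖lam‖))
        ≤ ‖besselF n (Complex.sqrt lam) β‖ := by
  obtain ⟨r₁, hr₁, -, C, hC, hF⟩ := exists_norm_mul_integral_besselK_sub_le
  obtain ⟨r₂, hr₂, D, hD, hA⟩ := exists_Gamma_mul_cpow_eq
  -- `β < exp (-(3456 C + 1))` makes `log (1/|lam|) ≥ 4 log (1/β)` exceed `13824 C`, so that the error
  -- `C |z| ≤ C β²` is dominated by `β² log (1/|lam|)`
  refine ⟨min (min r₁ r₂) (min (min (1 / 100) (1 / (100 * D)))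
      (min (1 / (216 * C)) (Real.exp (-(3456 * C + 1))))), by positivity, 1 / 13824, by norm_num, ?_⟩
  intro n hn β hβ lam hlam hlt
  obtain ⟨hβ0, hβ1⟩ := hβ
  simp only [lt_min_iff] at hβ1
  obtain ⟨⟨hb1, hb2⟩, ⟨hb3, hb4⟩, hb5, hb6⟩ := hβ1
  obtain ⟨ν, hμ, hσ, hστ, hτ1, hτ2, hν⟩ := besselOrder_sub_one_bounds hn hβ0 (by linarith)
  have hlam0 : lam ≠ 0 := Complex.slitPlane_ne_zero hlam
  have hln : 0 < ‖lam‖ := norm_pos_iff.2 hlam0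
  set z := Complex.sqrt lam with hz
  have hzre : 0 < z.re := complex_sqrt_re_pos hlam
  have hz0 : z ≠ 0 := by intro h; rw [h] at hzre; simp at hzre
  have hlogz : Complex.log z = Complex.log lam / 2 := log_complex_sqrt hlam0
  set L := -Real.log ‖lam‖ with hL
  set θ := lam.arg / 2 with hθ
  have hlogz2 : Complex.log z = -(L / 2 : ℝ) + θ * Complex.I := by
    rw [hlogz, hL, hθ]
    apply Complex.ext
    · simp [Complex.log_re]
      ring
    · simp [Complex.log_im]
  have hznorm : ‖z‖ = Real.exp (-(L / 2)) := by
    rw [← Complex.exp_log hz0, Complex.norm_exp, hlogz2]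
    simp
  have hLβ : 4 * (3456 * C + 1) < L := by
    have h1 : Real.log ‖lam‖ < Real.log (β ^ 4) := Real.log_lt_log hln hlt
    have h2 : Real.log β < -(3456 * C + 1) := by
      rwa [Real.log_lt_iff_lt_exp hβ0]
    rw [Real.log_pow] at h1
    push_cast at h1
    linarith
  have hzβ : ‖z‖ ≤ β ^ 2 := by
    have h1 : ‖z‖ ^ 2 = ‖lam‖ := by
      rw [hznorm, ← Real.exp_nat_mul, show ((2 : ℕ) : ℝ) * -(L / 2) = Real.log ‖lam‖ by
        rw [hL]; push_cast; ring, Real.exp_log hln]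
    have h2 : ‖z‖ ^ 2 ≤ (β ^ 2) ^ 2 := by rw [h1, ← pow_mul]; exact hlt.le
    exact le_of_sq_le_sq h2 (by positivity)
  have hθ1 : |θ| ≤ Real.pi / 2 := by
    rw [hθ, abs_div, abs_two]
    linarith [Complex.abs_arg_le_pi lam]
  have hτ0 : ν.im ≠ 0 := by
    intro h
    rw [h, abs_zero] at hτ1
    linarith
  set κ := Real.log 2 - Real.eulerMascheroniConstant with hκ
  have hκ1 : |κ| ≤ 1 := by
    have h1 := Real.one_half_lt_eulerMascheroniConstant
    have h2 := Real.eulerMascheroniConstant_lt_two_thirds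
    have h3 := Real.log_two_gt_d9
    have h4 := Real.log_two_lt_d9
    rw [abs_le]
    constructor <;> linarith
  have hκ2 := abs_le.1 hκ1
  set X := κ + L / 2 with hX
  have hXL : L / 4 ≤ X := by linarith
  have hX1 : 1 ≤ X := by linarith
  obtain ⟨hq, ρ, hρ, hmain⟩ := hA ν (hν.trans hb2.le) hσ
  have hE := hF ν (hν.trans hb1.le) hσ hτ0 z hzre (hzβ.trans (by nlinarith))
  rw [hmain z hz0] at hE
  set w := ν * ((κ : ℝ) - Complex.log z) + ρ with hw
  set q := ν * limitConstant ν with hqdef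
  set τ := ν.im with hτdef
  set σ := ν.re with hσdef
  have hsqτ : |τ| ^ 2 = τ ^ 2 := sq_abs τ
  have hσsmall : σ ≤ |τ| := by nlinarith [abs_nonneg τ]
  have hρ2 : ‖ρ‖ ≤ 2 * D * τ ^ 2 := by
    refine hρ.trans ?_
    have h1 : ‖ν‖ ^ 2 = σ ^ 2 + τ ^ 2 := by
      rw [Complex.sq_norm, Complex.normSq_apply, sq, sq]
    have h2 : σ ^ 2 ≤ τ ^ 2 := by rw [← hsqτ]; gcongr
    rw [h1]
    calc D * (σ ^ 2 + τ ^ 2) ≤ D * (τ ^ 2 + τ ^ 2) := by gcongr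
      _ = 2 * D * τ ^ 2 := by ring
  have hDτ : 2 * D * |τ| ≤ 1 / 100 := by
    rw [lt_div_iff₀ (by positivity)] at hb4
    calc 2 * D * |τ| ≤ 2 * D * (β / 2) := by gcongr
      _ ≤ 1 / 100 := by linarith
  have hwdiff : w - (σ + τ * Complex.I) * (X - θ * Complex.I) = ρ := by
    rw [hw, hlogz2, hX, hσdef, hτdef, Complex.re_add_im]
    push_cast
    ring
  have hexp := norm_exp_sub_one_ge (X := X) (θ := θ) (w := w) hσ hστ (by linarith) hDτ hθ1 hX1
    (by rw [hwdiff]; exact hρ2)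
  -- the power of `|lam|` in the claim comes from `Re w ≥ Re ν · log (1/|lam|) / 2 - 1`
  have hwre : σ * L / 2 - 1 ≤ w.re := by
    have h1 : w.re = σ * X + τ * θ + ρ.re := by
      have := congrArg Complex.re hwdiff
      simp at this
      linarith
    have h2 := Complex.abs_re_le_norm ρ
    have h3 := (abs_le.1 (h2.trans hρ2)).1
    have h4 : |τ * θ| ≤ |τ| * (Real.pi / 2) := by
      rw [abs_mul]; gcongr
    have h5 := (abs_le.1 h4).1
    have h6 : 2 * D * τ ^ 2 ≤ 1 / 100 * |τ| := by
      rw [← hsqτ, sq, ← mul_assoc]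
      gcongr
    have h7 : |τ| * (Real.pi / 2) ≤ |τ| * 2 := by
      gcongr
      linarith [Real.pi_lt_four]
    have h8 : σ * (-1) ≤ σ * κ := by
      gcongr
      exact hκ2.1
    rw [h1, hX, mul_add]
    linarith
  set m := min 1 (β ^ 2 * L) with hm
  have hm1 : m ≤ 1 := min_le_left _ _
  have hm2 : m ≤ β ^ 2 * L := min_le_right _ _
  have hL0 : 0 < L := by linarith
  have hm0 : 0 < m := lt_min one_pos (by positivity)
  have hmτ : m / 64 ≤ min 1 (τ ^ 2 * X) := by
    refine le_min (by linarith) ?_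
    have h1 : β ^ 2 / 16 ≤ τ ^ 2 := by
      rw [← hsqτ]
      calc β ^ 2 / 16 = (β / 4) ^ 2 := by ring
        _ ≤ |τ| ^ 2 := by gcongr
    calc m / 64 ≤ β ^ 2 / 16 * (L / 4) := by linarith
      _ ≤ τ ^ 2 * X := by gcongr
  set e := Real.exp (σ * L / 2) with he
  have he1 : 1 ≤ e := Real.one_le_exp (by positivity)
  have hew : e / 3 ≤ Real.exp w.re := by
    have h1 : Real.exp (σ * L / 2 - 1) ≤ Real.exp w.re := Real.exp_le_exp.2 hwre
    rw [Real.exp_sub] at h1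
    refine le_trans ?_ h1
    gcongr
    linarith [Real.exp_one_lt_d9]
  have hmainlow : e * m / 6912 ≤ ‖q * Complex.exp w - q‖ := by
    rw [show q * Complex.exp w - q = q * (Complex.exp w - 1) by ring, norm_mul]
    calc e * m / 6912 = 1 / 2 * (1 / 18 * (e / 3) * (m / 64)) := by ring
      _ ≤ 1 / 2 * (1 / 18 * Real.exp w.re * min 1 (τ ^ 2 * X)) := by gcongr
      _ ≤ _ := by gcongr
  have hCz : C * ‖z‖ ≤ e * m / 13824 := by
    have h1 : C * ‖z‖ ≤ m / 13824 := by
      have h2 : C * ‖z‖ ≤ C * β ^ 2 := by gcongr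
      have h3 : C * β ^ 2 ≤ 1 / 13824 := by
        rw [lt_div_iff₀ (by positivity)] at hb5
        have h5 : C * β ^ 2 ≤ C * (1 / 100 * β) := by
          rw [sq]
          gcongr
        linarith
      have h4 : C * β ^ 2 ≤ β ^ 2 * L / 13824 := by
        have h5 : C ≤ L / 13824 := by linarith
        calc C * β ^ 2 ≤ L / 13824 * β ^ 2 := by gcongr
          _ = β ^ 2 * L / 13824 := by ring
      rw [le_div_iff₀ (by norm_num)]
      exact le_min (by linarith) (by linarith)
    have h2 : 1 * m ≤ e * m := by gcongr
    linarith
  set F := besselF n z β with hFdef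
  rw [← hμ, ← besselF_eq hn] at hE
  have hfinal : e * m / 13824 ≤ β * ‖z‖ * ‖F‖ := by
    have h1 := norm_sub_norm_le (q * Complex.exp w - q) (ν * (z * F))
    rw [norm_sub_rev] at hE
    have h2 : ‖ν * (z * F)‖ ≤ β * ‖z‖ * ‖F‖ := by
      rw [norm_mul, norm_mul, mul_assoc]
      gcongr
    linarith
  have hpow : ‖lam‖ ^ (-((besselOrder n β).re / 2)) = e / ‖z‖ := by
    rw [hμ, Real.rpow_def_of_pos hln, hznorm, he, ← Real.exp_sub, Complex.add_re, Complex.one_re]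
    congr 1
    rw [hL]
    ring
  have hz1 : 0 < ‖z‖ := norm_pos_iff.2 hz0
  rw [hpow, show -(β ^ 2 * Real.log ‖lam‖) = β ^ 2 * L by rw [hL]; ring, ← hm,
    show 1 / 13824 / β * (e / ‖z‖) * m = (e * m / 13824) / (β * ‖z‖) by field_simp,
    div_le_iff₀ (by positivity)]
  linarith

lemma exp_neg_inv_le_pow_four {β : ℝ} (hβ0 : 0 < β) (hβ1 : β ≤ 1 / 933120) :
    Real.exp (-(1 / (6 * β))) ≤ β ^ 4 := by
  have h := Real.pow_div_factorial_le_exp (1 / (6 * β)) (by positivity) 5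
  rw [Real.exp_neg]
  refine inv_le_of_inv_le₀ (by positivity) (le_trans ?_ h)
  rw [show ((5 : ℕ).factorial : ℝ) = 120 by norm_num [Nat.factorial],
    show (1 / (6 * β)) ^ 5 / 120 = (β ^ 4)⁻¹ * (1 / (933120 * β)) by field_simp; norm_num]
  refine le_mul_of_one_le_right (by positivity) ?_
  rw [one_le_div (by positivity)]
  linarith

theorem mainTheorem5 (ε : ℝ) (hε : ε ∈ Set.Ioo (0 : ℝ) (Real.pi / 2)) :
    ∃ β₀ : ℝ, 0 < β₀ ∧ ∃ c : ℝ, 0 < c ∧ ∃ C : ℝ, 0 < C ∧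
      ∀ n : ℤ, |n| = 1 → ∀ β ∈ Set.Ioo (0 : ℝ) β₀,
        (∀ lam ∈ sector (Real.pi - ε) ∩ Metric.ball (0 : ℂ) (β ^ 4),
          c / β * ‖lam‖ ^ (-((besselOrder n β).re / 2)) * min 1 (-(β ^ 2 * Real.log ‖lam‖))
            ≤ ‖besselF n (Complex.sqrt lam) β‖) ∧
        (∀ lam ∈ sector (Real.pi - ε) ∩ Metric.ball (0 : ℂ) (Real.exp (-(1 / (6 * β)))),
          1 / ‖besselF n (Complex.sqrt lam) β‖ ≤ C * ‖lam‖ ^ ((besselOrder n β).re / 2)) ∧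
        zerosF n β ∩ Metric.ball (0 : ℂ) (Real.exp (-(1 / (6 * β)))) = ∅ := by
  obtain ⟨β₁, hβ₁, c, hc, hlow⟩ := exists_besselF_lower_bound
  have hsector : sector (Real.pi - ε) ⊆ Complex.slitPlane := by
    rintro lam ⟨h0, harg⟩
    refine Complex.mem_slitPlane_iff_arg.2 ⟨fun h => ?_, h0⟩
    rw [h, abs_of_pos Real.pi_pos] at harg
    linarith [hε.1]
  refine ⟨min β₁ (1 / 933120), by positivity, c, hc, 6 / c, by positivity, fun n hn β hβ => ?_⟩
  have hβ0 : 0 < β := hβ.1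
  have hβ1 : β < β₁ := hβ.2.trans_le (min_le_left _ _)
  have hβ2 : β < 1 / 933120 := hβ.2.trans_le (min_le_right _ _)
  -- for `|lam| < exp (-1/(6β))` the minimum is at least `β/6`, cancelling the factor `1/β`
  have hball : ∀ lam ∈ Complex.slitPlane, ‖lam‖ < Real.exp (-(1 / (6 * β))) →
      c / 6 * ‖lam‖ ^ (-((besselOrder n β).re / 2)) ≤ ‖besselF n (Complex.sqrt lam) β‖ := by
    intro lam hlam hlt
    have hln : 0 < ‖lam‖ := norm_pos_iff.2 (Complex.slitPlane_ne_zero hlam)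
    refine le_trans ?_ (hlow n hn β ⟨hβ0, hβ1⟩ lam hlam
      (hlt.trans_le (exp_neg_inv_le_pow_four hβ0 hβ2.le)))
    have hlog : Real.log ‖lam‖ < -(1 / (6 * β)) := by rwa [Real.log_lt_iff_lt_exp hln]
    have hm : β / 6 ≤ min 1 (-(β ^ 2 * Real.log ‖lam‖)) := by
      refine le_min (by linarith) ?_
      calc β / 6 = β ^ 2 * (1 / (6 * β)) := by field_simp
        _ ≤ β ^ 2 * -Real.log ‖lam‖ := by
          gcongr
          linarith
        _ = _ := by ring
    calc c / 6 * ‖lam‖ ^ (-((besselOrder n β).re / 2))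
        = c / β * ‖lam‖ ^ (-((besselOrder n β).re / 2)) * (β / 6) := by field_simp
      _ ≤ _ := by gcongr
  refine ⟨?_, ?_, ?_⟩
  · rintro lam ⟨hs, hb⟩
    exact hlow n hn β ⟨hβ0, hβ1⟩ lam (hsector hs) (mem_ball_zero_iff.1 hb)
  · rintro lam ⟨hs, hb⟩
    have hln : 0 < ‖lam‖ := norm_pos_iff.2 hs.1
    have h := hball lam (hsector hs) (mem_ball_zero_iff.1 hb)
    rw [Real.rpow_neg hln.le] at h
    have hp : 0 < ‖lam‖ ^ ((besselOrder n β).re / 2) := by positivity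
    calc 1 / ‖besselF n (Complex.sqrt lam) β‖
        ≤ 1 / (c / 6 * (‖lam‖ ^ ((besselOrder n β).re / 2))⁻¹) := by gcongr
      _ = 6 / c * ‖lam‖ ^ ((besselOrder n β).re / 2) := by field_simp
  · refine eq_empty_of_forall_notMem ?_
    rintro lam ⟨⟨hslit, hzero⟩, hb⟩
    have h := hball lam hslit (mem_ball_zero_iff.1 hb)
    have hln : 0 < ‖lam‖ := norm_pos_iff.2 (Complex.slitPlane_ne_zero hslit)
    rw [hzero, norm_zero] at h
    have : 0 < c / 6 * ‖lam‖ ^ (-((besselOrder n β).re / 2)) := by positivity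
    linarith
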